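/- Let $n\ge 0$ and let $\gamma:\mathbb C^n\to\mathbb C^n$ be an invertible holomorphic map (a biholomorphism, linear or not) which is a contraction centred at $0$: $\gamma(0)=0$, and for every compact set $K\subset\mathbb C^n$ and every open neighbourhood $U$ of $0$ there is $N$ such that $\gamma^m(K)\subset U$ for all integers $m>N$. Let $H=(\mathbb C^n\setminus 0)/\langle\gamma\rangle$ be the corresponding Hopf manifold, with the complex structure induced from $\mathbb C^n\setminus 0$. Then $H$ admits a locally conformally Kähler (LCK) metric with potential. That is, there are a smooth Hermitian metric $h$ on $H$, a holomorphic Galois covering $\pi:\tilde H\to H$ with connected total space (empty if $n=0$, when $H$ is empty), a Kähler metric $\tilde g$ on $\tilde H$ with fundamental form $\tilde\omega$, and a smooth function $\psi:\tilde H\to\mathbb R$ with $\psi>0$, such that 1. every deck transformation $\varphi$ of $\pi$ is a holomorphic homothety of $(\tilde H,\tilde g)$, i.e. $\varphi$ is holomorphic and $\varphi^*\tilde g=c\,\tilde g$ for a constant $c>0$ depending on $\varphi$; 2. $\pi^*h=f\,\tilde g$ for a smooth positive function $f$ on $\tilde H$; 3. $\psi$ is a potential of $\tilde g$, i.e. $\tilde\omega=dd^c\psi$,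 where $d^c\psi=-d\psi\circ J$ and $J$ is the complex structure; 4. for every deck transformation $\varphi$ there is a constant $c$ with $\psi\circ\varphi=c\,\psi$. -/

import Mathlib

open scoped Manifold ContDiff Topology

/-!
## Complex manifolds, viewed as real manifolds

A complex manifold modelled on the complex normed space `E` is a charted space `M` over `E` with
`IsManifold 𝓘(ℂ, E) ω M` (holomorphic transition maps). With the same charts it is a real manifold.
-/

section ComplexManifold

variable {E : Type*} [NormedAddCommGroup E] [NormedSpace ℂ E]
  {M : Type*} [TopologicalSpace M] [ChartedSpace E M]

/-- The real manifold underlying a complex manifold. -/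
instance isManifold_real_of_complex [h : IsManifold 𝓘(ℂ, E) ω M] : IsManifold 𝓘(ℝ, E) ω M := by
  apply isManifold_of_contDiffOn
  intro e e' he he'
  have h1 := (contDiffGroupoid ω 𝓘(ℂ, E)).compatible he he'
  have h2 := contMDiffOn_of_mem_contDiffGroupoid h1
  rw [contMDiffOn_iff_contDiffOn] at h2
  have h3 := h2.restrict_scalars ℝ
  simpa using h3

/-- The complex structure `J` on the tangent spaces: multiplication by `i`. (A tangent vector at `x`
is represented in the preferred chart at `x`; since the transition maps are holomorphic, their
differentials commute with `i`, so that the choice of the chart plays no role.) -/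
noncomputable def complexJ (x : M) :
    TangentSpace 𝓘(ℝ, E) x →L[ℝ] TangentSpace 𝓘(ℝ, E) x :=
  (Complex.I • ContinuousLinearMap.id ℝ E : E →L[ℝ] E)

theorem complexJ_complexJ (x : M) (v : TangentSpace 𝓘(ℝ, E) x) :
    complexJ x (complexJ x v) = -v := by
  change (Complex.I • (Complex.I • (show E from v)) : E) = -(show E from v)
  rw [smul_smul, Complex.I_mul_I, neg_one_smul]

variable (E M) in
/-- A real differential `k`-form on `M`. -/
abbrev RealForm (k : ℕ) : Type _ :=
  (x : M) → (TangentSpace 𝓘(ℝ, E) x) [⋀^Fin k]→L[ℝ] ℝ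

/-- The expression of a differential form in the chart at `x₀`: its pullback to the model space
under the inverse of the chart. -/
noncomputable def RealForm.inChart {k : ℕ} (α : RealForm E M k) (x₀ : M) :
    E → E [⋀^Fin k]→L[ℝ] ℝ := fun z =>
  (α ((chartAt E x₀).symm z)).compContinuousLinearMap
    (mfderiv 𝓘(ℝ, E) 𝓘(ℝ, E) (chartAt E x₀).symm z)

/-- The exterior derivative of a differential form on `M`: at `x` it is computed in the chart
at `x` and pulled back to `M`. -/
noncomputable def RealForm.d {k : ℕ} (α : RealForm E M k) : RealForm E M (k + 1) := fun x =>
  (extDeriv (α.inChart x) (chartAt E x x)).compContinuousLinearMap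
    (mfderiv 𝓘(ℝ, E) 𝓘(ℝ, E) (chartAt E x) x)

/-- The real `1`-form `dᶜψ = - dψ ∘ J`, for a real function `ψ`. -/
noncomputable def dc (ψ : M → ℝ) : RealForm E M 1 := fun x =>
  ContinuousAlternatingMap.ofSubsingleton ℝ (TangentSpace 𝓘(ℝ, E) x) ℝ (0 : Fin 1)
    (-((show TangentSpace 𝓘(ℝ, E) x →L[ℝ] ℝ from mfderiv 𝓘(ℝ, E) 𝓘(ℝ, ℝ) ψ x).comp (complexJ x)))

variable (E M) in
/-- A (smooth) Hermitian metric on the complex manifold `M`, given by its real part: a smooth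
Riemannian metric for which the complex structure is orthogonal. -/
structure HermitianMetric [IsManifold 𝓘(ℂ, E) ω M] extends
    Bundle.ContMDiffRiemannianMetric 𝓘(ℝ, E) ∞ E (fun x : M => TangentSpace 𝓘(ℝ, E) x) where
  inner_complexJ (x : M) (v w : TangentSpace 𝓘(ℝ, E) x) :
    inner x (complexJ x v) (complexJ x w) = inner x v w

namespace HermitianMetric

variable [IsManifold 𝓘(ℂ, E) ω M]

theorem inner_complexJ_self (g : HermitianMetric E M) (x : M) (v : TangentSpace 𝓘(ℝ, E) x) :
    g.inner x (complexJ x v) v = 0 := by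
  have h := g.inner_complexJ x (complexJ x v) v
  rw [complexJ_complexJ, map_neg, _root_.neg_apply, g.symm x v] at h
  linarith

/-- The fundamental form `ω(v, w) = g(J v, w)` of a Hermitian metric `g`. -/
noncomputable def fundamentalForm (g : HermitianMetric E M) : RealForm E M 2 := fun x =>
  { toFun := fun v => g.inner x (complexJ x (v 0)) (v 1)
    map_update_add' := by
      intro _ m i u v
      fin_cases i <;> simp
    map_update_smul' := by
      intro _ m i c u
      fin_cases i <;> simp
    map_eq_zero_of_eq' := by
      intro v i j hij hne
      have h01 : v 0 = v 1 := by
        fin_cases i <;> fin_cases j <;> simp_all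
      rw [h01]
      exact g.inner_complexJ_self x (v 1)
    cont := by
      let L : E →L[ℝ] E →L[ℝ] ℝ := (g.inner x).comp (complexJ x)
      have hL : Continuous fun p : E × E => L p.1 p.2 := L.continuous₂
      have hv : Continuous fun v : Fin 2 → E => (v 0, v 1) := by fun_prop
      exact hL.comp hv }

/-- A Hermitian metric is Kähler if its fundamental form is closed. -/
def IsKahler (g : HermitianMetric E M) : Prop :=
  g.fundamentalForm.d = 0

/-- `ψ` is a Kähler potential of `g`: a smooth function with `ω = d dᶜψ`, where `ω` is the
fundamental form of `g`. -/
def IsKahlerPotential (g : HermitianMetric E M) (ψ : M → ℝ) : Prop :=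
  ContMDiff 𝓘(ℝ, E) 𝓘(ℝ, ℝ) ∞ ψ ∧ g.fundamentalForm = (dc ψ).d

end HermitianMetric
end ComplexManifold

/-!
## Quotients of manifolds by free properly discontinuous actions
-/

section Quotient

open MulAction

/-- The quotient of a manifold by a free, properly discontinuous action by `C^n` maps, with the
charts given by the sections of the projection, is a `C^n` manifold. -/
theorem isManifold_orbitRel_quotient {𝕜 : Type*} [NontriviallyNormedField 𝕜]
    {E : Type*} [NormedAddCommGroup E] [NormedSpace 𝕜 E] (n : ℕ∞ω)
    {X : Type*} [TopologicalSpace X] [ChartedSpace E X] [IsManifold 𝓘(𝕜, E) n X]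
    {G : Type*} [Group G] [MulAction G X]
    [ProperlyDiscontinuousSMul G X] [ContinuousConstSMul G X] [IsCancelSMul G X]
    [T2Space X] [LocallyCompactSpace X]
    (hG : ∀ g : G, ContMDiff 𝓘(𝕜, E) 𝓘(𝕜, E) n (fun x : X => g • x)) :
    IsManifold 𝓘(𝕜, E) n (orbitRel.Quotient G X) := by
  apply isManifold_of_contDiffOn
  rintro e e' ⟨q, rfl⟩ ⟨q', rfl⟩
  set hf : IsLocalHomeomorph (Quotient.mk (orbitRel G X)) :=
    (isQuotientCoveringMap_quotientMk_of_properlyDiscontinuousSMul (G := G)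
      (E := X)).isCoveringMap.isLocalHomeomorph with hf_def
  generalize (Quotient.mk_surjective (s := orbitRel G X)).hasRightInverse.choose q = a
  generalize (Quotient.mk_surjective (s := orbitRel G X)).hasRightInverse.choose q' = a'
  intro z hz
  apply ContDiffAt.contDiffWithinAt
  rw [← contMDiffAt_iff_contDiffAt]
  have hz' : z ∈ (((hf.localInverseAt a).trans (chartAt E a)).symm ≫ₕ
      ((hf.localInverseAt a').trans (chartAt E a'))).source := by simpa using hz
  clear hz
  have hza : z ∈ (chartAt E a).target := by
    simp only [OpenPartialHomeomorph.trans_source, OpenPartialHomeomorph.symm_source,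
      OpenPartialHomeomorph.trans_target, Set.mem_inter_iff] at hz'
    exact hz'.1.1
  have hzb : Quotient.mk (orbitRel G X) ((chartAt E a).symm z) ∈
      (hf.localInverseAt a').source := by
    have h := hz'
    simp only [OpenPartialHomeomorph.trans_source, OpenPartialHomeomorph.symm_source,
      Set.mem_inter_iff, Set.mem_preimage, OpenPartialHomeomorph.trans_symm_eq_symm_trans_symm,
      OpenPartialHomeomorph.coe_trans, Function.comp_apply] at h
    simpa using h.2.1
  have hzc : hf.localInverseAt a' (Quotient.mk (orbitRel G X) ((chartAt E a).symm z)) ∈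
      (chartAt E a').source := by
    have h := hz'
    simp only [OpenPartialHomeomorph.trans_source, OpenPartialHomeomorph.symm_source,
      Set.mem_inter_iff, Set.mem_preimage, OpenPartialHomeomorph.trans_symm_eq_symm_trans_symm,
      OpenPartialHomeomorph.coe_trans, Function.comp_apply] at h
    simpa using h.2.2
  have hmk := hf.apply_localInverseAt_of_mem hzb
  set y := (chartAt E a).symm z with hy
  set y' := hf.localInverseAt a' (Quotient.mk (orbitRel G X) y) with hy'
  obtain ⟨g, hg : g • y = y'⟩ : y' ∈ orbit G y := Quotient.exact hmk
  have hcφ : ContinuousAt (chartAt E a).symm z := (chartAt E a).symm.continuousAt hza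
  have hcg : ContinuousAt (fun w => g • (chartAt E a).symm w) z :=
    (continuous_const_smul g).continuousAt.comp hcφ
  have hy't : y' ∈ (hf.localInverseAt a').target := (hf.localInverseAt a').map_source hzb
  have hev : (fun w => (chartAt E a') (g • (chartAt E a).symm w)) =ᶠ[𝓝 z]
      (𝓘(𝕜, E) ∘ (((hf.localInverseAt a).trans (chartAt E a)).symm ≫ₕ
      ((hf.localInverseAt a').trans (chartAt E a'))) ∘ 𝓘(𝕜, E).symm) := by
    have hev1 : ∀ᶠ w in 𝓝 z, g • (chartAt E a).symm w ∈ (hf.localInverseAt a').target := by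
      apply hcg.eventually_mem
      apply (hf.localInverseAt a').open_target.mem_nhds
      rw [← hy, hg]
      exact hy't
    filter_upwards [hev1] with w hw
    have h1 : Quotient.mk (orbitRel G X) ((chartAt E a).symm w) =
        Quotient.mk (orbitRel G X) (g • (chartAt E a).symm w) :=
      (Quotient.sound (show (orbitRel G X).r _ _ from ⟨g, rfl⟩)).symm
    have h2 : hf.localInverseAt a' (Quotient.mk (orbitRel G X) (g • (chartAt E a).symm w)) =
        g • (chartAt E a).symm w := by
      have h3 := (hf.localInverseAt a').right_inv hw
      rwa [hf.localInverseAt_symm] at h3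
    simp only [modelWithCornersSelf_coe, modelWithCornersSelf_coe_symm, Function.comp_apply, id,
      OpenPartialHomeomorph.coe_trans, OpenPartialHomeomorph.trans_symm_eq_symm_trans_symm,
      hf.localInverseAt_symm]
    rw [h1, h2]
  refine ContMDiffAt.congr_of_eventuallyEq ?_ hev.symm
  have hc1 : ContMDiffAt 𝓘(𝕜, E) 𝓘(𝕜, E) n (chartAt E a).symm z :=
    (contMDiffOn_chart_symm (I := 𝓘(𝕜, E)) (n := n) (x := a)).contMDiffAt
      ((chartAt E a).open_target.mem_nhds hza)
  have hc2 : ContMDiffAt 𝓘(𝕜, E) 𝓘(𝕜, E) n (chartAt E a') (g • (chartAt E a).symm z) := by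
    refine (contMDiffOn_chart (I := 𝓘(𝕜, E)) (n := n) (x := a')).contMDiffAt
      ((chartAt E a').open_source.mem_nhds ?_)
    rw [← hy, hg]
    exact hzc
  exact hc2.comp z ((hG g).contMDiffAt.comp z hc1)

end Quotient

/-!
## Locally conformally Kähler metrics
-/

section LCK

universe u v

variable {E : Type v} [NormedAddCommGroup E] [NormedSpace ℂ E]
  {M : Type u} [TopologicalSpace M] [ChartedSpace E M]
  {N : Type u} [TopologicalSpace N] [ChartedSpace E N]

/-- `φ` is a deck transformation of `π : N → M`. -/
def IsDeckTransformation (π : N → M) (φ : N ≃ₜ N) : Prop :=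
  ∀ y, π (φ y) = π y

variable (E) in
/-- `π : N → M` is a holomorphic covering of complex manifolds, with connected total space, and
`M` is the quotient of `N` by the deck group.

(`PreconnectedSpace N` rather than `ConnectedSpace N`: the total space is allowed to be empty, which
occurs only over the empty manifold.) -/
structure IsGaloisHolomorphicCovering (π : N → M) : Prop where
  isCoveringMap : IsCoveringMap π
  surjective : Function.Surjective π
  isLocalDiffeomorph : IsLocalDiffeomorph 𝓘(ℂ, E) 𝓘(ℂ, E) ω π
  preconnectedSpace : PreconnectedSpace N
  exists_deck : ∀ y y' : N, π y = π y' → ∃ φ : N ≃ₜ N, IsDeckTransformation π φ ∧ φ y = y'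

namespace HermitianMetric

variable [IsManifold 𝓘(ℂ, E) ω M] [IsManifold 𝓘(ℂ, E) ω N]

/-- `φ` is a holomorphic homothety of `g`: it is holomorphic and `φ^* g = c g` for a
constant `c > 0`. -/
def IsHolomorphicHomothety (g : HermitianMetric E N) (φ : N → N) : Prop :=
  ContMDiff 𝓘(ℂ, E) 𝓘(ℂ, E) ω φ ∧
    ∃ c : ℝ, 0 < c ∧ ∀ (y : N) (v w : TangentSpace 𝓘(ℝ, E) y),
      g.inner (φ y) (mfderiv 𝓘(ℝ, E) 𝓘(ℝ, E) φ y v) (mfderiv 𝓘(ℝ, E) 𝓘(ℝ, E) φ y w) =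
        c * g.inner y v w

/-- The pullback of the Hermitian metric `h` under `π : N → M` is conformal to `g`:
`π^* h = f g` for a smooth positive function `f` on `N`. -/
def PullbackConformalTo (h : HermitianMetric E M) (π : N → M) (g : HermitianMetric E N) : Prop :=
  ∃ f : N → ℝ, ContMDiff 𝓘(ℝ, E) 𝓘(ℝ, ℝ) ∞ f ∧ (∀ y, 0 < f y) ∧
    ∀ (y : N) (v w : TangentSpace 𝓘(ℝ, E) y),
      h.inner (π y) (mfderiv 𝓘(ℝ, E) 𝓘(ℝ, E) π y v) (mfderiv 𝓘(ℝ, E) 𝓘(ℝ, E) π y w) =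
        f y * g.inner y v w

/-- `π : N → M` with the Kähler metric `g` on `N` is a Kähler covering of `(M, h)`: a holomorphic
covering whose deck group acts on `(N, g)` by holomorphic homotheties, and such that the pullback
of `h` is conformal to `g`. -/
structure IsKahlerCovering (h : HermitianMetric E M) (π : N → M) (g : HermitianMetric E N) :
    Prop where
  isCovering : IsGaloisHolomorphicCovering E π
  isKahler : g.IsKahler
  homothety : ∀ φ : N ≃ₜ N, IsDeckTransformation π φ → g.IsHolomorphicHomothety φ
  conformal : h.PullbackConformalTo π g

/-- `ψ` is an automorphic potential on the covering `π : N → M`: a positive Kähler potential of `g`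
which every deck transformation multiplies by a constant. -/
structure IsAutomorphicPotential (π : N → M) (g : HermitianMetric E N) (ψ : N → ℝ) : Prop where
  isKahlerPotential : g.IsKahlerPotential ψ
  pos : ∀ y, 0 < ψ y
  automorphic : ∀ φ : N ≃ₜ N, IsDeckTransformation π φ → ∃ c : ℝ, ∀ y, ψ (φ y) = c * ψ y

/-- `h` is a locally conformally Kähler metric: `(M, h)` has a Kähler covering. -/
def IsLCK (h : HermitianMetric E M) : Prop :=
  ∃ (N : Type u) (_ : TopologicalSpace N) (_ : ChartedSpace E N) (_ : IsManifold 𝓘(ℂ, E) ω N)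
    (π : N → M) (g : HermitianMetric E N), h.IsKahlerCovering π g

/-- `h` is a locally conformally Kähler metric with potential: `(M, h)` has a Kähler covering
whose Kähler metric has a positive automorphic potential. -/
def IsLCKWithPotential (h : HermitianMetric E M) : Prop :=
  ∃ (N : Type u) (_ : TopologicalSpace N) (_ : ChartedSpace E N) (_ : IsManifold 𝓘(ℂ, E) ω N)
    (π : N → M) (g : HermitianMetric E N), h.IsKahlerCovering π g ∧
      ∃ ψ : N → ℝ, IsAutomorphicPotential π g ψ

theorem IsLCKWithPotential.isLCK {h : HermitianMetric E M} (hh : h.IsLCKWithPotential) :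
    h.IsLCK := by
  obtain ⟨N, t, c, m, π, g, hg, -⟩ := hh
  exact ⟨N, t, c, m, π, g, hg⟩

end HermitianMetric

end LCK

/-!
## Contractions and Hopf manifolds
-/

section Hopf

open MulAction TopologicalSpace

/-- `γ : V → V` is a contraction centred at `x`: it fixes `x`, and for each compact set `K` and each
open neighbourhood `U` of `x`, all sufficiently high iterates of `γ` map `K` into `U`. -/
structure IsContraction {V : Type*} [TopologicalSpace V] (γ : V → V) (x : V) : Prop where
  map_center : γ x = x
  mapsTo_iterate : ∀ K U : Set V, IsCompact K → IsOpen U → x ∈ U →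
    ∃ N : ℕ, ∀ m > N, Set.MapsTo γ^[m] K U

/-- `ℂⁿ ∖ 0`. -/
def puncturedSpace (n : ℕ) : Opens (EuclideanSpace ℂ (Fin n)) :=
  ⟨{0}ᶜ, isOpen_compl_singleton⟩

variable {n : ℕ}

/-- The restriction to `ℂⁿ ∖ 0` of a bijection of `ℂⁿ` fixing `0`. -/
def puncturedPerm (γ : Equiv.Perm (EuclideanSpace ℂ (Fin n))) (h0 : γ 0 = 0) :
    Equiv.Perm (puncturedSpace n) :=
  γ.subtypeEquiv fun a => by
    change a ≠ 0 ↔ γ a ≠ 0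
    rw [not_iff_not]
    exact ⟨fun h => by rw [h, h0], fun h => γ.injective (h.trans h0.symm)⟩

theorem coe_puncturedPerm (γ : Equiv.Perm (EuclideanSpace ℂ (Fin n))) (h0 : γ 0 = 0)
    (x : puncturedSpace n) : (puncturedPerm γ h0 x : EuclideanSpace ℂ (Fin n)) = γ x := rfl

instance locallyCompactSpace_puncturedSpace : LocallyCompactSpace (puncturedSpace n) :=
  (puncturedSpace n).isOpen.locallyCompactSpace

variable (γ : EuclideanSpace ℂ (Fin n) ≃ₘ^ω⟮𝓘(ℂ, EuclideanSpace ℂ (Fin n)),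
    𝓘(ℂ, EuclideanSpace ℂ (Fin n))⟯ EuclideanSpace ℂ (Fin n))
  (hγ : IsContraction γ 0)

/-- The cyclic group `⟨γ⟩` acting on `ℂⁿ ∖ 0`. -/
def hopfGroup : Subgroup (Equiv.Perm (puncturedSpace n)) :=
  Subgroup.zpowers (puncturedPerm γ.toEquiv hγ.map_center)

variable {γ hγ}

theorem contMDiff_codRestrict_puncturedSpace
    (f : puncturedSpace n → puncturedSpace n)
    (hf : ContMDiff 𝓘(ℂ, EuclideanSpace ℂ (Fin n)) 𝓘(ℂ, EuclideanSpace ℂ (Fin n)) ω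
      (fun x => (f x : EuclideanSpace ℂ (Fin n)))) :
    ContMDiff 𝓘(ℂ, EuclideanSpace ℂ (Fin n)) 𝓘(ℂ, EuclideanSpace ℂ (Fin n)) ω f := fun x =>
  (ChartedSpace.liftPropWithinAt_subtypeVal_comp_iff f Set.univ x).1 (hf x)

theorem contMDiff_hopfGroup_smul (g : hopfGroup γ hγ) :
    ContMDiff 𝓘(ℂ, EuclideanSpace ℂ (Fin n)) 𝓘(ℂ, EuclideanSpace ℂ (Fin n)) ω
      (fun x : puncturedSpace n => g • x) := by
  obtain ⟨g, hg⟩ := g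
  change ContMDiff _ _ _ (fun x : puncturedSpace n => g x)
  have h1 : ContMDiff 𝓘(ℂ, EuclideanSpace ℂ (Fin n)) 𝓘(ℂ, EuclideanSpace ℂ (Fin n)) ω
      (fun x : puncturedSpace n => puncturedPerm γ.toEquiv hγ.map_center x) :=
    contMDiff_codRestrict_puncturedSpace _ (γ.contMDiff_toFun.comp contMDiff_subtype_val)
  have h2 : ContMDiff 𝓘(ℂ, EuclideanSpace ℂ (Fin n)) 𝓘(ℂ, EuclideanSpace ℂ (Fin n)) ω
      (fun x : puncturedSpace n => (puncturedPerm γ.toEquiv hγ.map_center)⁻¹ x) :=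
    contMDiff_codRestrict_puncturedSpace _ (γ.contMDiff_invFun.comp contMDiff_subtype_val)
  obtain ⟨k, rfl⟩ := hg
  induction k with
  | zero => exact contMDiff_id
  | succ m ih =>
    have h := h1.comp ih
    refine h.congr fun x => ?_
    beta_reduce
    rw [add_comm, zpow_add, zpow_one]
    rfl
  | pred m ih =>
    have h := h2.comp ih
    refine h.congr fun x => ?_
    beta_reduce
    rw [sub_eq_neg_add, zpow_add, zpow_neg_one]
    rfl

instance continuousConstSMul_hopfGroup :
    ContinuousConstSMul (hopfGroup γ hγ) (puncturedSpace n) where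
  continuous_const_smul g := (contMDiff_hopfGroup_smul g).continuous

theorem coe_puncturedPerm_pow (m : ℕ) (x : puncturedSpace n) :
    (((puncturedPerm γ.toEquiv hγ.map_center) ^ m) x : EuclideanSpace ℂ (Fin n)) =
      γ^[m] x := by
  induction m generalizing x with
  | zero => rfl
  | succ m ih =>
    rw [pow_succ, Equiv.Perm.mul_apply, ih, Function.iterate_succ_apply]
    rfl

theorem exists_iterate_disjoint
    (hγ : IsContraction γ 0) (K L : Set (puncturedSpace n)) (hK : IsCompact K)
    (hL : IsCompact L) :
    ∃ N : ℕ, ∀ m > N, ∀ x ∈ K, ((puncturedPerm γ.toEquiv hγ.map_center) ^ m) x ∉ L := by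
  obtain ⟨N, hN⟩ := hγ.mapsTo_iterate (Subtype.val '' K) (Subtype.val '' L)ᶜ
    (hK.image continuous_subtype_val) (hL.image continuous_subtype_val).isClosed.isOpen_compl
    (by rintro ⟨x, -, hx⟩; exact x.2 hx)
  refine ⟨N, fun m hm x hx hxL => ?_⟩
  refine hN m hm ⟨x, hx, rfl⟩ ⟨_, hxL, ?_⟩
  exact coe_puncturedPerm_pow (hγ := hγ) m x

instance properlyDiscontinuousSMul_hopfGroup :
    ProperlyDiscontinuousSMul (hopfGroup γ hγ) (puncturedSpace n) where
  finite_disjoint_inter_image := by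
    intro K L hK hL
    obtain ⟨N, hN⟩ := exists_iterate_disjoint hγ K L hK hL
    obtain ⟨N', hN'⟩ := exists_iterate_disjoint hγ L K hL hK
    set p := puncturedPerm γ.toEquiv hγ.map_center with hp
    refine Set.Finite.subset ((Set.finite_Icc (-(N' : ℤ)) N).image
      (fun k : ℤ => (⟨p ^ k, k, rfl⟩ : hopfGroup γ hγ))) ?_
    rintro ⟨_, k, rfl⟩ ⟨_, ⟨x, hxK, rfl⟩, hxL⟩
    refine ⟨k, ⟨?_, ?_⟩, rfl⟩
    · by_contra! hk
      obtain ⟨m, rfl⟩ : ∃ m : ℕ, k = -m := ⟨k.natAbs, by omega⟩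
      refine hN' m (by omega) _ hxL ?_
      change (p ^ m) ((p ^ (-(m : ℤ))) x) ∈ K
      simpa using hxK
    · by_contra! hk
      obtain ⟨m, rfl⟩ : ∃ m : ℕ, k = m := ⟨k.natAbs, by omega⟩
      refine hN m (by omega) _ hxK ?_
      change (p ^ (m : ℤ)) x ∈ L at hxL
      simpa using hxL

instance isCancelSMul_hopfGroup : IsCancelSMul (hopfGroup γ hγ) (puncturedSpace n) := by
  rw [isCancelSMul_iff_eq_one_of_smul_eq]
  rintro ⟨_, k, rfl⟩ x hx
  set p := puncturedPerm γ.toEquiv hγ.map_center with hp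
  change (p ^ k) x = x at hx
  obtain ⟨N, hN⟩ := exists_iterate_disjoint hγ {x} {x} isCompact_singleton
    isCompact_singleton
  have key : ∀ j : ℕ, 0 < j → (p ^ j) x ≠ x := by
    intro j hj hjx
    refine hN (j * (N + 1)) (by nlinarith) x rfl ?_
    change (p ^ (j * (N + 1))) x = x
    rw [pow_mul]
    exact Function.IsFixedPt.perm_pow hjx (N + 1)
  have hk : k = 0 := by
    rcases lt_trichotomy k 0 with h | h | h
    · obtain ⟨m, rfl⟩ : ∃ m : ℕ, k = -m := ⟨k.natAbs, by omega⟩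
      refine absurd ?_ (key m (by omega))
      rw [zpow_neg, zpow_natCast, Equiv.Perm.inv_eq_iff_eq] at hx
      exact hx.symm
    · exact h
    · obtain ⟨m, rfl⟩ : ∃ m : ℕ, k = m := ⟨k.natAbs, by omega⟩
      exact absurd (by simpa using hx) (key m (by omega))
  apply Subtype.ext
  change p ^ k = 1
  rw [hk, zpow_zero]

variable (γ hγ) in
/-- The Hopf manifold `(ℂⁿ ∖ 0) / ⟨γ⟩` of an invertible holomorphic contraction `γ` of `ℂⁿ` centred
at `0`, with the quotient topology and with the charts induced by the projection. -/
abbrev HopfManifold : Type :=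
  orbitRel.Quotient (hopfGroup γ hγ) (puncturedSpace n)

instance isManifold_hopfManifold :
    IsManifold 𝓘(ℂ, EuclideanSpace ℂ (Fin n)) ω (HopfManifold γ hγ) :=
  isManifold_orbitRel_quotient ω contMDiff_hopfGroup_smul

end Hopf

/-! Everything reduces to a smooth, positive, strictly plurisubharmonic function `ψ` on `ℂⁿ ∖ 0`
with `ψ ∘ γ = c ψ`, `c > 0`. Then `ddᶜψ` is a Kähler form on the covering `ℂⁿ ∖ 0`, the powers of
`γ` act on it by homotheties, and `ψ⁻¹ ddᶜψ` is invariant, so it descends to the Hopf manifold.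

To find `ψ`, no normal form of `γ` is needed. By the Schwarz lemma a high iterate of `γ` halves
norms on the unit ball, so a finite sum `P` of the functions `‖γ^k z‖²` is strictly plurisubharmonic
and strictly decreases along `γ` on `{P ≤ 1/2} ∖ 0`. By compactness the decrease leaves a gap at the
boundary level; an affine change turns `P` into `Q` with `Q ∘ γ ≤ -2` on `{Q ≤ R}`, `R > 2`
(`exists_normalized_psh_exhaustion`).

On the shell `U = {Q < R, Q ∘ γ⁻¹ > 2}`, which meets every orbit, take a regularized maximum `F` of
`Q` and `c Q ∘ γ⁻¹`, with `c` small. Where both `z` and `γ z` lie in `U`, the first function wins at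
`z` and the second at `γ z`, so `F (γ z) = c Q z = c F z` (`exists_local_automorphic_potential`).
Hence `ψ z = c ^ (-k) F (γ^k z)`, for any `k` with `γ^k z ∈ U`, is well defined. It inherits
smoothness and strict plurisubharmonicity from `F`, because these survive regularized maxima and
composition with biholomorphisms. -/

/-! ### The complex Hessian and its behaviour under composition. -/

section ComplexHessian

variable {E F : Type*} [NormedAddCommGroup E] [NormedSpace ℂ E]
  [NormedAddCommGroup F] [NormedSpace ℂ F]

/-- Multiplication by `i`, as a real linear map. -/
noncomputable def mulI (E : Type*) [NormedAddCommGroup E] [NormedSpace ℂ E] : E →L[ℝ] E :=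
  Complex.I • ContinuousLinearMap.id ℝ E

@[simp] theorem mulI_apply (v : E) : mulI E v = Complex.I • v := rfl

/-- The `J`-invariant part of the real Hessian of `f`, up to the factor `2`. -/
noncomputable def complexHessian (f : E → ℝ) (z : E) : E →L[ℝ] E →L[ℝ] ℝ :=
  fderiv ℝ (fderiv ℝ f) z + (fderiv ℝ (fderiv ℝ f) z).bilinearComp (mulI E) (mulI E)

theorem complexHessian_apply (f : E → ℝ) (z v w : E) :
    complexHessian f z v w = fderiv ℝ (fderiv ℝ f) z v w +
      fderiv ℝ (fderiv ℝ f) z (Complex.I • v) (Complex.I • w) := rfl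

theorem complexHessian_congr {f g : E → ℝ} {z : E} (h : f =ᶠ[𝓝 z] g) :
    complexHessian f z = complexHessian g z := by
  unfold complexHessian
  rw [h.fderiv.fderiv_eq]

theorem complexHessian_symm {f : E → ℝ} {z : E} (hf : ContDiffAt ℝ 2 f z) (v w : E) :
    complexHessian f z v w = complexHessian f z w v := by
  have h : IsSymmSndFDerivAt ℝ f z := hf.isSymmSndFDerivAt (by simp)
  rw [complexHessian_apply, complexHessian_apply, h v w, h (Complex.I • v)]

theorem complexHessian_I_smul (f : E → ℝ) (z v w : E) :
    complexHessian f z (Complex.I • v) (Complex.I • w) = complexHessian f z v w := by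
  simp only [complexHessian_apply, smul_smul, Complex.I_mul_I, neg_one_smul, map_neg,
    neg_apply, neg_neg]
  ring

theorem ContDiffAt.differentiableAt_fderiv {G : Type*} [NormedAddCommGroup G] [NormedSpace ℝ G]
    {f : E → G} {z : E} (hf : ContDiffAt ℝ 2 f z) : DifferentiableAt ℝ (fderiv ℝ f) z :=
  (hf.fderiv_right (m := 1) (by norm_num)).differentiableAt one_ne_zero

theorem ContDiffAt.eventually_differentiableAt {G : Type*} [NormedAddCommGroup G]
    [NormedSpace ℝ G] {f : E → G} {z : E} (hf : ContDiffAt ℝ 2 f z) :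
    ∀ᶠ y in 𝓝 z, DifferentiableAt ℝ f y := by
  filter_upwards [hf.eventually (by simp)] with y hy using hy.differentiableAt (by simp)

theorem complexHessian_add {f g : E → ℝ} {z : E} (hf : ContDiffAt ℝ 2 f z)
    (hg : ContDiffAt ℝ 2 g z) :
    complexHessian (fun y => f y + g y) z = complexHessian f z + complexHessian g z := by
  have h : fderiv ℝ (fun y => f y + g y) =ᶠ[𝓝 z] fun y => fderiv ℝ f y + fderiv ℝ g y := by
    filter_upwards [hf.eventually_differentiableAt, hg.eventually_differentiableAt] with y h1 h2
    exact fderiv_fun_add h1 h2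
  ext v w
  simp only [complexHessian_apply, h.fderiv_eq,
    fderiv_fun_add hf.differentiableAt_fderiv hg.differentiableAt_fderiv, add_apply]
  ring

theorem complexHessian_const_mul {f : E → ℝ} {z : E} (hf : ContDiffAt ℝ 2 f z) (c : ℝ) :
    complexHessian (fun y => c * f y) z = c • complexHessian f z := by
  have h : fderiv ℝ (fun y => c * f y) =ᶠ[𝓝 z] fun y => c • fderiv ℝ f y := by
    filter_upwards [hf.eventually_differentiableAt] with y h1
    exact fderiv_const_mul h1 c
  ext v w
  simp only [complexHessian_apply, h.fderiv_eq,
    fderiv_fun_const_smul hf.differentiableAt_fderiv, smul_apply, smul_eq_mul]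
  ring

theorem complexHessian_sub_const (f : E → ℝ) (z : E) (c : ℝ) :
    complexHessian (fun y => f y - c) z = complexHessian f z := by
  have h : fderiv ℝ (fun y => f y - c) = fderiv ℝ f := funext fun y => fderiv_sub_const c
  simp only [complexHessian, h]

theorem complexHessian_sum {ι : Type*} (s : Finset ι) {f : ι → E → ℝ} {z : E}
    (hf : ∀ i ∈ s, ContDiffAt ℝ 2 (f i) z) :
    complexHessian (fun y => ∑ i ∈ s, f i y) z = ∑ i ∈ s, complexHessian (f i) z := by
  classical
  induction s using Finset.induction_on with
  | empty =>
    ext v w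
    simp [complexHessian_apply]
  | insert i s hi ih =>
    simp only [Finset.sum_insert hi]
    rw [complexHessian_add (hf i (by simp))
      (ContDiffAt.sum fun j hj => hf j (by simp [hj])), ih fun j hj => hf j (by simp [hj])]

/-- The real second derivative of a holomorphic map is complex bilinear. -/
theorem fderiv_fderiv_I_smul {γ : E → F} {z : E} (hγ : ContDiffAt ℂ 2 γ z) (v w : E) :
    fderiv ℝ (fderiv ℝ γ) z (Complex.I • v) (Complex.I • w) =
      -fderiv ℝ (fderiv ℝ γ) z v w := by
  have h1 : fderiv ℝ γ =ᶠ[𝓝 z]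
      (ContinuousLinearMap.restrictScalarsL ℂ E F ℝ ℝ) ∘ (fderiv ℂ γ) := by
    filter_upwards [hγ.eventually (by simp)] with y hy
    exact (hy.differentiableAt (by simp)).fderiv_restrictScalars ℝ
  have h2 : DifferentiableAt ℂ (fderiv ℂ γ) z :=
    (hγ.fderiv_right (m := 1) (by norm_num)).differentiableAt one_ne_zero
  have h3 : ∀ v w, fderiv ℝ (fderiv ℝ γ) z v w = fderiv ℂ (fderiv ℂ γ) z v w := by
    intro v w
    rw [h1.fderiv_eq, fderiv_comp z (ContinuousLinearMap.differentiableAt _)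
      (h2.restrictScalars ℝ), h2.fderiv_restrictScalars ℝ, ContinuousLinearMap.fderiv]
    rfl
  rw [h3, h3, map_smul, map_smul, smul_apply, smul_smul, Complex.I_mul_I, neg_one_smul]

theorem fderiv_I_smul {γ : E → F} {z : E} (hγ : DifferentiableAt ℂ γ z) (v : E) :
    fderiv ℝ γ z (Complex.I • v) = Complex.I • fderiv ℝ γ z v := by
  rw [hγ.fderiv_restrictScalars ℝ]
  simp

/-- The chain rule for second derivatives has an extra term `f'(γ''(v, w))`. As `γ''` is complex
bilinear, this term changes sign when `v, w` are replaced by `iv, iw`, and it cancels in the sum. -/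
theorem complexHessian_comp {f : F → ℝ} {γ : E → F} {z : E} (hf : ContDiffAt ℝ 2 f (γ z))
    (hγ : ContDiffAt ℂ 2 γ z) (v w : E) :
    complexHessian (fun y => f (γ y)) z v w =
      complexHessian f (γ z) (fderiv ℝ γ z v) (fderiv ℝ γ z w) := by
  have hγ' : ContDiffAt ℝ 2 γ z := hγ.restrict_scalars ℝ
  have h : fderiv ℝ (fun y => f (γ y)) =ᶠ[𝓝 z]
      fun y => (fderiv ℝ f (γ y)).comp (fderiv ℝ γ y) := by
    filter_upwards [hγ'.continuousAt.eventually hf.eventually_differentiableAt,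
      hγ'.eventually_differentiableAt] with y h1 h2
    exact fderiv_comp y h1 h2
  have hd : DifferentiableAt ℝ (fun y => fderiv ℝ f (γ y)) z :=
    hf.differentiableAt_fderiv.comp z (hγ'.differentiableAt (by simp))
  have h2 : ∀ v w, fderiv ℝ (fderiv ℝ (fun y => f (γ y))) z v w =
      fderiv ℝ (fderiv ℝ f) (γ z) (fderiv ℝ γ z v) (fderiv ℝ γ z w) +
        fderiv ℝ f (γ z) (fderiv ℝ (fderiv ℝ γ) z v w) := by
    intro v w
    have h3 : fderiv ℝ (fun y => fderiv ℝ f (γ y)) z =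
        (fderiv ℝ (fderiv ℝ f) (γ z)).comp (fderiv ℝ γ z) :=
      fderiv_comp z hf.differentiableAt_fderiv (hγ'.differentiableAt (by simp))
    rw [h.fderiv_eq, fderiv_clm_comp hd hγ'.differentiableAt_fderiv, h3]
    simp [add_comm]
  have hγ1 : DifferentiableAt ℂ γ z := hγ.differentiableAt (by simp)
  rw [complexHessian_apply, complexHessian_apply, h2, h2, fderiv_fderiv_I_smul hγ,
    fderiv_I_smul hγ1, fderiv_I_smul hγ1, map_neg]
  ring

/-- For convex `m` the second term is nonnegative; this is what makes convex combinations of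
plurisubharmonic functions through `m` work. -/
theorem complexHessian_scalar_comp {m : ℝ → ℝ} {u : E → ℝ} {z : E} (hm : ContDiffAt ℝ 2 m (u z))
    (hu : ContDiffAt ℝ 2 u z) (v : E) :
    complexHessian (fun y => m (u y)) z v v =
      deriv m (u z) * complexHessian u z v v +
        deriv (deriv m) (u z) * (fderiv ℝ u z v ^ 2 + fderiv ℝ u z (Complex.I • v) ^ 2) := by
  have hu1 : DifferentiableAt ℝ u z := hu.differentiableAt (by simp)
  have hm1 : DifferentiableAt ℝ (deriv m) (u z) := by
    have h := (hm.fderiv_right (m := 1) (by norm_num)).differentiableAt one_ne_zero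
    have h' : deriv m = fun t => fderiv ℝ m t 1 := by
      ext t; simp
    rw [h']
    exact h.clm_apply (differentiableAt_const _)
  have h : fderiv ℝ (fun y => m (u y)) =ᶠ[𝓝 z] fun y => deriv m (u y) • fderiv ℝ u y := by
    filter_upwards [hu.continuousAt.eventually (hm.eventually (by simp)),
      hu.eventually_differentiableAt] with y h1 h2
    exact ((h1.differentiableAt (by simp)).hasDerivAt.comp_hasFDerivAt y h2.hasFDerivAt).fderiv
  have h2 : ∀ v w, fderiv ℝ (fderiv ℝ (fun y => m (u y))) z v w =
      deriv m (u z) * fderiv ℝ (fderiv ℝ u) z v w +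
        deriv (deriv m) (u z) * (fderiv ℝ u z v * fderiv ℝ u z w) := by
    intro v w
    have h3 : HasFDerivAt (fun y => deriv m (u y)) (deriv (deriv m) (u z) • fderiv ℝ u z) z :=
      hm1.hasDerivAt.comp_hasFDerivAt z hu1.hasFDerivAt
    rw [h.fderiv_eq, fderiv_fun_smul h3.differentiableAt hu.differentiableAt_fderiv, h3.fderiv]
    simp [mul_assoc]
  rw [complexHessian_apply, complexHessian_apply, h2, h2]
  ring

theorem complexHessian_norm_sq {H : Type*} [NormedAddCommGroup H] [InnerProductSpace ℂ H]
    (z v : H) : complexHessian (fun y : H => ‖y‖ ^ 2) z v v = 4 * ‖v‖ ^ 2 := by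
  let : InnerProductSpace ℝ H := InnerProductSpace.rclikeToReal ℂ H
  have h1 : fderiv ℝ (fun y : H => ‖y‖ ^ 2) =
      ((2 : ℝ) • innerSL ℝ : H →L[ℝ] H →L[ℝ] ℝ) := by
    funext y
    rw [fderiv_norm_sq_apply, ← Nat.cast_smul_eq_nsmul ℝ]
    rfl
  have h2 (u : H) : ((2 : ℝ) • innerSL ℝ : H →L[ℝ] H →L[ℝ] ℝ) u u = 2 * ‖u‖ ^ 2 :=
    congrArg (2 * ·) (real_inner_self_eq_norm_sq u)
  rw [complexHessian_apply, h1, ContinuousLinearMap.fderiv, h2, h2, norm_smul, Complex.norm_I]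
  ring

/-! ### Regularized maxima. -/

/-- A smoothing of `t ↦ max t 0`. -/
noncomputable def smoothPosPart (t : ℝ) : ℝ := ∫ s in (0 : ℝ)..t, Real.smoothTransition s

theorem hasDerivAt_smoothPosPart (t : ℝ) :
    HasDerivAt smoothPosPart (Real.smoothTransition t) t :=
  intervalIntegral.integral_hasDerivAt_right
    (Real.smoothTransition.continuous.intervalIntegrable _ _)
    (Real.smoothTransition.continuous.stronglyMeasurableAtFilter _ _)
    Real.smoothTransition.continuousAt

theorem deriv_smoothPosPart : deriv smoothPosPart = Real.smoothTransition :=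
  funext fun t => (hasDerivAt_smoothPosPart t).deriv

theorem contDiff_smoothPosPart : ContDiff ℝ ∞ smoothPosPart := by
  rw [contDiff_infty_iff_deriv, deriv_smoothPosPart]
  exact ⟨fun t => (hasDerivAt_smoothPosPart t).differentiableAt, Real.smoothTransition.contDiff⟩

theorem smoothPosPart_of_nonpos {t : ℝ} (ht : t ≤ 0) : smoothPosPart t = 0 := by
  unfold smoothPosPart
  rw [intervalIntegral.integral_congr (g := fun _ => (0 : ℝ))]
  · simp
  · intro s hs
    rw [Set.uIcc_of_ge ht] at hs
    exact Real.smoothTransition.zero_of_nonpos hs.2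

theorem smoothPosPart_nonneg (t : ℝ) : 0 ≤ smoothPosPart t := by
  rcases le_total t 0 with ht | ht
  · rw [smoothPosPart_of_nonpos ht]
  · exact intervalIntegral.integral_nonneg ht fun s _ => Real.smoothTransition.nonneg s

/-- The integrand is `1` beyond `1`. The constant offset is compensated later by a shift, so that
the regularized maximum equals the larger function exactly. -/
theorem smoothPosPart_of_one_le {t : ℝ} (ht : 1 ≤ t) :
    smoothPosPart t = t + (smoothPosPart 1 - 1) := by
  unfold smoothPosPart
  have hi : ∀ a b, IntervalIntegrable Real.smoothTransition MeasureTheory.volume a b :=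
    fun a b => Real.smoothTransition.continuous.intervalIntegrable _ _
  rw [← intervalIntegral.integral_add_adjacent_intervals (hi 0 1) (hi 1 t),
    intervalIntegral.integral_congr (a := 1) (g := fun _ => (1 : ℝ))]
  · simp; ring
  · intro s hs
    rw [Set.uIcc_of_le ht] at hs
    exact Real.smoothTransition.one_of_one_le hs.1

theorem smoothPosPart_one_le : smoothPosPart 1 ≤ 1 := by
  have h := intervalIntegral.integral_mono_on (a := 0) (b := 1) (μ := MeasureTheory.volume)
    zero_le_one (Real.smoothTransition.continuous.intervalIntegrable _ _)
    (g := fun _ => (1 : ℝ)) (by simp) fun s _ => Real.smoothTransition.le_one s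
  simpa [smoothPosPart] using h

/-- A regularized maximum of strictly plurisubharmonic functions is strictly
plurisubharmonic. -/
theorem complexHessian_regularizedMax_pos {a b : E → ℝ} {z : E} (ha : ContDiffAt ℝ 2 a z)
    (hb : ContDiffAt ℝ 2 b z) {v : E} (hav : 0 < complexHessian a z v v)
    (hbv : 0 < complexHessian b z v v) :
    0 < complexHessian (fun y => b y + smoothPosPart (a y - b y)) z v v := by
  have hm : ContDiff ℝ 2 smoothPosPart := contDiff_smoothPosPart.of_le (by norm_cast)
  have hab : ContDiffAt ℝ 2 (fun y => a y - b y) z := ha.sub hb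
  have hsub : complexHessian (fun y => a y - b y) z v v =
      complexHessian a z v v - complexHessian b z v v := by
    have h := complexHessian_add ha (g := fun y => (-1) * b y) (contDiffAt_const.mul hb)
    rw [complexHessian_const_mul hb] at h
    simp only [neg_mul, one_mul, ← sub_eq_add_neg] at h
    rw [h]
    simp [sub_eq_add_neg]
  rw [complexHessian_add hb (g := fun y => smoothPosPart (a y - b y))
    (hm.contDiffAt.comp z hab), add_apply, add_apply,
    complexHessian_scalar_comp hm.contDiffAt hab, hsub, deriv_smoothPosPart]
  -- With `s` the smoothed positive part and `s'`, `s''` taken at `a - b`, the Hessian is `(1 - s')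
  -- H(b) + s' H(a)` plus a nonnegative multiple of `s'' ≥ 0`. As `0 ≤ s' ≤ 1`, the first two terms
  -- form a convex combination of positive numbers.
  have h0 := Real.smoothTransition.nonneg (a z - b z)
  have h1 := Real.smoothTransition.le_one (a z - b z)
  have h2 : 0 ≤ deriv Real.smoothTransition (a z - b z) :=
    Real.smoothTransition.monotone.deriv_nonneg
  have h3 := mul_nonneg h2 (add_nonneg (sq_nonneg (fderiv ℝ (fun y => a y - b y) z v))
    (sq_nonneg (fderiv ℝ (fun y => a y - b y) z (Complex.I • v))))
  nlinarith [mul_nonneg h0 hav.le, mul_nonneg (sub_nonneg.2 h1) hbv.le]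

end ComplexHessian

/-! ### Construction of the automorphic potential. -/

section Potential

theorem contDiff_iterate {E : Type*} [NormedAddCommGroup E] [NormedSpace ℂ E] {g : E → E}
    (hg : ContDiff ℂ ω g) (k : ℕ) : ContDiff ℂ ω g^[k] := by
  induction k with
  | zero => exact contDiff_id
  | succ k ih => exact ih.comp hg

theorem contDiff_zpow {E : Type*} [NormedAddCommGroup E] [NormedSpace ℂ E] {T : Equiv.Perm E}
    (hT : ContDiff ℂ ω T) (hT' : ContDiff ℂ ω T.symm) (k : ℤ) : ContDiff ℂ ω ⇑(T ^ k) := by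
  cases k with
  | ofNat k =>
    rw [Int.ofNat_eq_natCast, zpow_natCast, ← Equiv.Perm.iterate_eq_pow]
    exact contDiff_iterate hT k
  | negSucc k =>
    rw [zpow_negSucc, ← inv_pow, ← Equiv.Perm.iterate_eq_pow]
    exact contDiff_iterate hT' (k + 1)

theorem fderiv_zpow_apply_ne_zero {E : Type*} [NormedAddCommGroup E] [NormedSpace ℂ E]
    {T : Equiv.Perm E} (hT : ContDiff ℂ ω T) (hT' : ContDiff ℂ ω T.symm) (k : ℤ) (z : E) {v : E}
    (hv : v ≠ 0) : fderiv ℝ ⇑(T ^ k) z v ≠ 0 := by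
  intro h
  have hd (j : ℤ) : Differentiable ℝ ⇑(T ^ j) :=
    ((contDiff_zpow hT hT' j).restrict_scalars ℝ).differentiable (by simp)
  have h1 : fderiv ℝ (⇑(T ^ (-k)) ∘ ⇑(T ^ k)) z = ContinuousLinearMap.id ℝ E := by
    rw [← Equiv.Perm.coe_mul, ← zpow_add, neg_add_cancel, zpow_zero, Equiv.Perm.coe_one]
    exact fderiv_id
  rw [fderiv_comp z (hd _ _) (hd _ _)] at h1
  have h2 := DFunLike.congr_fun h1 v
  rw [ContinuousLinearMap.comp_apply, h, map_zero] at h2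
  exact hv h2.symm

variable {V : Type*} [NormedAddCommGroup V] [InnerProductSpace ℂ V] [ProperSpace V]

/-- A holomorphic contraction strictly decreases a smooth strictly plurisubharmonic
exhaustion near its centre. -/
theorem exists_psh_exhaustion {g : V → V} (hg : ContDiff ℂ ω g) (hc : IsContraction g 0) :
    ∃ P : V → ℝ, ContDiff ℝ ∞ P ∧ (∀ z v, v ≠ 0 → 0 < complexHessian P z v v) ∧
      (∀ z, ‖z‖ ^ 2 ≤ P z) ∧ P 0 = 0 ∧ ∃ q < (1 / 2 : ℝ), ∀ z, P z ≤ 1 / 2 → P (g z) ≤ q := by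
  obtain ⟨N, hN⟩ := hc.mapsTo_iterate (Metric.closedBall 0 1) (Metric.ball 0 (1 / 2))
    (isCompact_closedBall _ _) Metric.isOpen_ball (by simp)
  have hg0 (k : ℕ) : g^[k] 0 = 0 := Function.iterate_fixed hc.map_center k
  have hgk (k : ℕ) : ContDiff ℝ ∞ g^[k] :=
    ((contDiff_iterate hg k).restrict_scalars ℝ).of_le le_top
  -- The sum telescopes: `P ∘ g - P` involves only `‖z‖²` and `‖g^(N+1) z‖²`.
  set P : V → ℝ := fun z => ∑ k ∈ Finset.range (N + 1), ‖g^[k] z‖ ^ 2 with hP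
  have hPk (k : ℕ) : ContDiff ℝ ∞ fun z => ‖g^[k] z‖ ^ 2 := (hgk k).norm_sq ℂ
  have hPc : ContDiff ℝ ∞ P := ContDiff.sum fun k _ => hPk k
  have hle (z) : ‖z‖ ^ 2 ≤ P z := by
    have := Finset.single_le_sum (s := Finset.range (N + 1)) (f := fun k => ‖g^[k] z‖ ^ 2)
      (fun k _ => sq_nonneg _) (Finset.mem_range.2 (Nat.succ_pos N))
    simpa using this
  have hstep (z) : P (g z) = P z - ‖z‖ ^ 2 + ‖g^[N + 1] z‖ ^ 2 := by
    have h1 := Finset.sum_range_succ (fun k => ‖g^[k] z‖ ^ 2) (N + 1)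
    rw [Finset.sum_range_succ'] at h1
    simp only [Function.iterate_zero, id, Function.iterate_succ_apply] at h1
    simp only [hP, Function.iterate_succ_apply]
    linarith
  have hlt (z) (hz : z ≠ 0) (hz1 : P z ≤ 1 / 2) : P (g z) < P z := by
    have hz2 : ‖z‖ < 1 := by nlinarith [hle z, norm_nonneg z]
    have h1 : ‖g^[N + 1] z‖ ≤ 1 / 2 * ‖z‖ := by
      -- Schwarz lemma: `g^(N+1)` fixes `0` and maps the unit ball into the ball of radius `1/2`.
      have h := Complex.dist_le_div_mul_dist_of_mapsTo_ball (f := g^[N + 1]) (c := 0) (R₁ := 1)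
        (R₂ := 1 / 2) (z := z)
        ((contDiff_iterate hg (N + 1)).differentiable (by simp)).differentiableOn
        (fun w hw => by
          rw [hg0]
          exact Metric.ball_subset_closedBall
            (hN (N + 1) (by omega) (Metric.ball_subset_closedBall hw)))
        (by simpa using hz2)
      rw [hg0] at h
      simpa using h
    have h2 : 0 < ‖z‖ := norm_pos_iff.2 hz
    rw [hstep]
    nlinarith [norm_nonneg (g^[N + 1] z)]
  have h0 : P 0 = 0 := by simp [hP, hg0]
  refine ⟨P, hPc, fun z v hv => ?_, hle, h0, ?_⟩
  · rw [hP, complexHessian_sum _ fun k _ =>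
      ((hPk k).of_le (by norm_cast)).contDiffAt, sum_apply,
      sum_apply]
    have h1 (k : ℕ) : complexHessian (fun z => ‖g^[k] z‖ ^ 2) z v v =
        4 * ‖fderiv ℝ g^[k] z v‖ ^ 2 := by
      rw [complexHessian_comp (f := fun y => ‖y‖ ^ 2) (contDiff_norm_sq ℂ).contDiffAt
        ((contDiff_iterate hg k).of_le le_top).contDiffAt, complexHessian_norm_sq]
    -- All terms are nonnegative, and the term `k = 0` is `4 ‖v‖²`, which gives strictness.
    refine Finset.sum_pos' (fun k _ => ?_) ⟨0, by simp, ?_⟩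
    · rw [h1]; positivity
    · rw [h1]
      have h2 : fderiv ℝ g^[0] z v = v := by
        rw [Function.iterate_zero, fderiv_id]; rfl
      rw [h2]
      have := norm_pos_iff.2 hv
      positivity
  · have hK : IsCompact {z | P z ≤ 1 / 2} := by
      refine (isCompact_closedBall (0 : V) 1).of_isClosed_subset
        (isClosed_le hPc.continuous continuous_const) fun z hz => ?_
      have hz : P z ≤ 1 / 2 := hz
      rw [mem_closedBall_zero_iff]
      nlinarith [hle z, norm_nonneg z]
    -- Compactness makes the pointwise decrease uniform: `q` is the maximum of `P ∘ g` on `{P ≤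
    -- 1/2}`.
    obtain ⟨z₀, hz₀, hmax⟩ := hK.exists_isMaxOn ⟨0, by simp [h0]⟩
      (hPc.continuous.comp hg.continuous).continuousOn
    refine ⟨P (g z₀), ?_, fun z hz => hmax hz⟩
    by_cases hz : z₀ = 0
    · rw [hz, hc.map_center, h0]; norm_num
    · exact (hlt z₀ hz hz₀).trans_le hz₀

theorem exists_normalized_psh_exhaustion {g : V → V} (hg : ContDiff ℂ ω g)
    (hc : IsContraction g 0) :
    ∃ (Q : V → ℝ) (R : ℝ), ContDiff ℝ ∞ Q ∧ (∀ z v, v ≠ 0 → 0 < complexHessian Q z v v) ∧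
      2 < R ∧ IsCompact {z | Q z ≤ R} ∧ (∀ z, Q z ≤ R → Q (g z) ≤ -2) ∧ Q 0 < R := by
  obtain ⟨P, hP, hpsh, hle, h0, q, hq, hPq⟩ := exists_psh_exhaustion hg hc
  -- The gap between the levels `q` and `1/2` is `4d`. The affine map `x ↦ 2/d * (x - (q + d))`
  -- sends `q` to `-2` and `1/2` to `6`, so `R = 6`.
  set d : ℝ := (1 / 2 - q) / 4 with hd
  have hd0 : 0 < d := by rw [hd]; linarith
  have hiff (x y : ℝ) : 2 / d * (x - (q + d)) ≤ 2 / d * (y - (q + d)) ↔ x ≤ y := by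
    rw [mul_le_mul_iff_right₀ (by positivity)]
    constructor <;> intro h <;> linarith
  have hR : 2 / d * (1 / 2 - (q + d)) = 6 := by
    have : (1 / 2 : ℝ) - (q + d) = 3 * d := by rw [hd]; ring
    rw [this]; field_simp; norm_num
  have hm2 : 2 / d * (q - (q + d)) = -2 := by field_simp; ring
  have hstep (z) (hz : 2 / d * (P z - (q + d)) ≤ 6) : 2 / d * (P (g z) - (q + d)) ≤ -2 := by
    rw [← hm2, hiff]
    rw [← hR, hiff] at hz
    exact hPq z hz
  refine ⟨fun z => 2 / d * (P z - (q + d)), 6, ?_, fun z v hv => ?_, by norm_num, ?_, hstep, ?_⟩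
  · exact contDiff_const.mul (hP.sub contDiff_const)
  · have hP2 : ContDiffAt ℝ 2 P z := (hP.of_le (by norm_cast)).contDiffAt
    rw [complexHessian_const_mul (hP2.sub contDiffAt_const), complexHessian_sub_const]
    exact mul_pos (by positivity) (hpsh z v hv)
  · refine (isCompact_closedBall (0 : V) 1).of_isClosed_subset
      (isClosed_le (by have := hP.continuous; fun_prop) continuous_const) fun z hz => ?_
    have hz : 2 / d * (P z - (q + d)) ≤ 6 := hz
    rw [← hR, hiff] at hz
    rw [mem_closedBall_zero_iff]
    nlinarith [hle z, norm_nonneg z]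
  · rw [← hR]
    simp only [h0]
    exact mul_lt_mul_of_pos_left (by linarith) (by positivity)

/-- `U` plays the role of a slightly enlarged fundamental domain: a point of `U` can have only
neighbouring translates in `U`, so automorphy has to be checked for a single application of `T`. -/
theorem exists_local_automorphic_potential {T : Equiv.Perm V} (hT : ContDiff ℂ ω T)
    (hT' : ContDiff ℂ ω T.symm) (hc : IsContraction T 0) :
    ∃ (c : ℝ) (F : V → ℝ) (U : Set V), 0 < c ∧ IsOpen U ∧ ContDiff ℝ ∞ F ∧
      (∀ z ∈ U, 0 < F z) ∧ (∀ z v, v ≠ 0 → 0 < complexHessian F z v v) ∧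
      (∀ z ≠ 0, ∃ k : ℤ, (T ^ k) z ∈ U) ∧ (∀ z ∈ U, ∀ j : ℕ, 2 ≤ j → (T ^ j) z ∉ U) ∧
      ∀ z ∈ U, T z ∈ U → F (T z) = c * F z := by
  obtain ⟨Q, R, hQ, hpsh, hR, hK, hstep, hQ0⟩ := exists_normalized_psh_exhaustion hT hc
  have hTs : ContDiff ℝ ∞ T.symm := (hT'.restrict_scalars ℝ).of_le le_top
  obtain ⟨C, hC⟩ := (hK.image (hQ.continuous.comp hTs.continuous)).bddAbove
  have hC (z) (hz : Q z ≤ R) : Q (T.symm z) ≤ C := hC ⟨z, hz, rfl⟩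
  set κ : ℝ := smoothPosPart 1 - 1 with hκ
  have hκ0 : κ ≤ 0 := by linarith [smoothPosPart_one_le]
  have hκ1 : -1 ≤ κ := by linarith [smoothPosPart_nonneg 1]
  -- Small enough that `c Q ∘ T⁻¹ ≤ 1` on `{Q ≤ R}`, which puts it at least `1` below `Q - κ`
  -- wherever `Q > 2`.
  set c : ℝ := (|C| + 1)⁻¹ with hc_def
  have hc0 : 0 < c := by positivity
  have hcC (x : ℝ) (hx : x ≤ C) : c * x ≤ 1 := by
    rw [hc_def, inv_mul_le_one₀ (by positivity)]
    linarith [le_abs_self C]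
  have hb : ContDiff ℝ ∞ fun z => c * Q (T.symm z) := contDiff_const.mul (hQ.comp hTs)
  have ha : ContDiff ℝ ∞ fun z => Q z - κ := hQ.sub contDiff_const
  have h2 : (2 : WithTop ℕ∞) ≤ ∞ := by norm_cast
  -- A regularized maximum of `Q - κ` and `c Q ∘ T⁻¹`. The shift by `κ` makes it equal to `Q`
  -- exactly where `Q - κ` exceeds the other function by at least `1`.
  refine ⟨c, fun z => c * Q (T.symm z) + smoothPosPart (Q z - κ - c * Q (T.symm z)),
    {z | Q z < R} ∩ {z | 2 < Q (T.symm z)}, hc0, ?_, ?_, ?_, ?_, ?_, ?_, ?_⟩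
  · exact (isOpen_lt hQ.continuous continuous_const).inter
      (isOpen_lt continuous_const (hQ.continuous.comp hTs.continuous))
  · exact hb.add (contDiff_smoothPosPart.comp (ha.sub hb))
  · rintro z ⟨-, hz : 2 < Q (T.symm z)⟩
    have := smoothPosPart_nonneg (Q z - κ - c * Q (T.symm z))
    have : 0 < c * Q (T.symm z) := by positivity
    linarith
  · intro z v hv
    refine complexHessian_regularizedMax_pos (a := fun z => Q z - κ) (ha.of_le h2).contDiffAt
      (hb.of_le h2).contDiffAt ?_ ?_
    · rw [complexHessian_sub_const]
      exact hpsh z v hv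
    · rw [complexHessian_const_mul (f := fun z => Q (T.symm z)) ((hQ.comp hTs).of_le h2).contDiffAt,
        smul_apply, smul_apply, smul_eq_mul,
        complexHessian_comp (hQ.of_le h2).contDiffAt (hT'.of_le le_top).contDiffAt]
      have h := fderiv_zpow_apply_ne_zero hT hT' (-1) z hv
      rw [zpow_neg_one] at h
      exact mul_pos hc0 (hpsh _ _ h)
  · intro z hz
    obtain ⟨N, hN⟩ := hc.mapsTo_iterate {z} {w | Q w < R} isCompact_singleton
      (isOpen_lt hQ.continuous continuous_const) hQ0
    obtain ⟨M, hM⟩ := hc.mapsTo_iterate _ {z}ᶜ hK isOpen_compl_singleton (Ne.symm hz)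
    -- Take the first time the orbit enters `{Q < R}`; the preceding point has `Q ≥ R > 2`. A first
    -- time exists because high iterates of `T` carry `{Q ≤ R}` off `z`, so far in the past the
    -- orbit is outside that set.
    obtain ⟨k, hk, hmin⟩ := Int.exists_least_of_bdd (P := fun k : ℤ => Q ((T ^ k) z) < R)
      ⟨-M, fun k hk => by
        by_contra! h
        obtain ⟨m, rfl⟩ : ∃ m : ℕ, k = -m := ⟨k.natAbs, by omega⟩
        refine hM m (by omega) hk.le ?_
        rw [Equiv.Perm.iterate_eq_pow, zpow_neg, zpow_natCast]
        exact (T ^ m).apply_symm_apply z⟩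
      ⟨(N + 1 : ℕ), by
        have := hN (N + 1) (by omega) rfl
        rwa [Equiv.Perm.iterate_eq_pow, ← zpow_natCast] at this⟩
    refine ⟨k, hk, ?_⟩
    have h1 : T.symm ((T ^ k) z) = (T ^ (k - 1)) z := by
      rw [sub_eq_neg_add, zpow_add, zpow_neg_one]; rfl
    change 2 < Q (T.symm ((T ^ k) z))
    rw [h1]
    by_contra! h
    have := hmin (k - 1) (by linarith)
    omega
  · rintro z ⟨hz : Q z < R, -⟩ j hj ⟨-, hj2 : 2 < Q (T.symm ((T ^ j) z))⟩
    -- Once in `{Q < R}`, the orbit stays at levels `Q ≤ -2` from the next step on. So `T^(j-1) z`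
    -- fails the condition `Q > 2` when `j ≥ 2`.
    have h1 (i : ℕ) : Q ((T ^ (i + 1)) z) ≤ -2 := by
      induction i with
      | zero => exact hstep z hz.le
      | succ i ih =>
        rw [pow_succ', Equiv.Perm.mul_apply]
        exact hstep _ (by linarith)
    obtain ⟨i, rfl⟩ : ∃ i, j = i + 1 + 1 := ⟨j - 2, by omega⟩
    rw [pow_succ', Equiv.Perm.mul_apply, Equiv.symm_apply_apply] at hj2
    linarith [h1 i]
  · rintro z ⟨hz : Q z < R, -⟩ ⟨-, hz2 : 2 < Q (T.symm (T z))⟩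
    rw [Equiv.symm_apply_apply] at hz2
    have h1 := hstep z hz.le
    have h3 := hcC _ (hC z hz.le)
    have h4 : 0 < c * Q z := by positivity
    simp only [Equiv.symm_apply_apply]
    -- At `T z`, `Q - κ ≤ -1 < 0 < c Q z`, so `F (T z) = c Q z`. At `z`, `Q - κ ≥ 2` and `c Q (T⁻¹
    -- z) ≤ 1`, so `F z = Q z`.
    rw [smoothPosPart_of_nonpos (by linarith), smoothPosPart_of_one_le (by linarith)]
    ring

/-- Every invertible holomorphic contraction `T` of `V` has a smooth positive strictly
plurisubharmonic function `ψ` on `V ∖ 0` with `ψ ∘ T = c ψ`. -/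
theorem exists_automorphic_potential {T : Equiv.Perm V} (hT : ContDiff ℂ ω T)
    (hT' : ContDiff ℂ ω T.symm) (hc : IsContraction T 0) :
    ∃ (c : ℝ) (ψ : V → ℝ), 0 < c ∧ (∀ z ≠ 0, ContDiffAt ℝ ∞ ψ z) ∧ (∀ z ≠ 0, 0 < ψ z) ∧
      (∀ z ≠ 0, ψ (T z) = c * ψ z) ∧ ∀ z ≠ 0, ∀ v ≠ 0, 0 < complexHessian ψ z v v := by
  classical
  obtain ⟨c, F, U, hc0, hU, hF, hFpos, hFpsh, hcov, hov, hFT⟩ :=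
    exists_local_automorphic_potential hT hT' hc
  have key (z) (k : ℤ) (j : ℕ) (hk : (T ^ k) z ∈ U) (hk' : (T ^ (k + j)) z ∈ U) :
      c ^ (-(k + j)) * F ((T ^ (k + j)) z) = c ^ (-k) * F ((T ^ k) z) := by
    have hadd : (T ^ (k + j)) z = (T ^ j) ((T ^ k) z) := by
      rw [add_comm, zpow_add, zpow_natCast, Equiv.Perm.mul_apply]
    rw [hadd] at hk' ⊢
    have hj : j < 2 := by
      by_contra! h
      exact hov _ hk j h hk'
    interval_cases j
    · simp
    · rw [pow_one] at hk' ⊢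
      rw [hFT _ hk hk', neg_add, zpow_add₀ hc0.ne']
      simp only [Nat.cast_one, zpow_neg_one]
      field_simp
  have key (z) (k k' : ℤ) (hk : (T ^ k) z ∈ U) (hk' : (T ^ k') z ∈ U) :
      c ^ (-k) * F ((T ^ k) z) = c ^ (-k') * F ((T ^ k') z) := by
    rcases le_total k k' with h | h
    · obtain ⟨j, rfl⟩ := Int.le.dest h
      exact (key z k j hk hk').symm
    · obtain ⟨j, rfl⟩ := Int.le.dest h
      exact key z k' j hk' hk
  -- The exponent is an arbitrary choice; `key` makes the value independent of it, so near each
  -- point one fixed `k` may be used.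
  set ψ : V → ℝ := fun z =>
    if h : ∃ k : ℤ, (T ^ k) z ∈ U then c ^ (-h.choose) * F ((T ^ h.choose) z) else 0 with hψ
  have hψk (z) (k : ℤ) (hk : (T ^ k) z ∈ U) : ψ z = c ^ (-k) * F ((T ^ k) z) := by
    have h : ∃ k : ℤ, (T ^ k) z ∈ U := ⟨k, hk⟩
    simp only [hψ, dif_pos h]
    exact key z _ _ h.choose_spec hk
  have hev (z) (k : ℤ) (hk : (T ^ k) z ∈ U) :
      ψ =ᶠ[𝓝 z] fun y => c ^ (-k) * F ((T ^ k) y) := by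
    filter_upwards [(contDiff_zpow hT hT' k).continuous.continuousAt.preimage_mem_nhds
      (hU.mem_nhds hk)] with y hy using hψk y k hy
  have hTk (k : ℤ) : ContDiff ℝ ∞ ⇑(T ^ k) :=
    ((contDiff_zpow hT hT' k).restrict_scalars ℝ).of_le le_top
  have h2 : (2 : WithTop ℕ∞) ≤ ∞ := by norm_cast
  refine ⟨c, ψ, hc0, fun z hz => ?_, fun z hz => ?_, fun z hz => ?_, fun z hz v hv => ?_⟩ <;>
    obtain ⟨k, hk⟩ := hcov z hz
  · exact (contDiff_const.mul (hF.comp (hTk k))).contDiffAt.congr_of_eventuallyEq (hev z k hk)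
  · rw [hψk z k hk]
    have := hFpos _ hk
    positivity
  · have h1 : (T ^ (k - 1)) (T z) = (T ^ k) z := by
      rw [← Equiv.Perm.mul_apply, ← zpow_add_one, sub_add_cancel]
    rw [hψk z k hk, hψk (T z) (k - 1) (by rwa [h1]), h1, neg_sub, sub_eq_add_neg,
      zpow_add₀ hc0.ne', zpow_one, mul_assoc]
  · rw [complexHessian_congr (hev z k hk),
      complexHessian_const_mul (f := fun z => F ((T ^ k) z)) ((hF.comp (hTk k)).of_le h2).contDiffAt,
      smul_apply, smul_apply, smul_eq_mul, complexHessian_comp (hF.of_le h2).contDiffAt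
        ((contDiff_zpow hT hT' k).of_le le_top).contDiffAt]
    exact mul_pos (by positivity) (hFpsh _ _ (fderiv_zpow_apply_ne_zero hT hT' k z hv))

end Potential

/-! ### Calculus on open subsets of a vector space, and `ddᶜ`. -/

section OpenSubset

open TopologicalSpace

variable {E : Type*} [NormedAddCommGroup E] {U : Opens E}

theorem Opens.chartAt_apply (x y : U) : chartAt E x y = y := rfl

theorem Opens.chartAt_source (x : U) : (chartAt E x).source = Set.univ := by
  rw [Opens.chartAt_eq, OpenPartialHomeomorph.subtypeRestr_source, chartAt_self_eq]
  rfl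

theorem Opens.mem_chartAt_target {x : U} {z : E} (hz : z ∈ U) : z ∈ (chartAt E x).target := by
  have h := (chartAt E x).map_source (x := ⟨z, hz⟩) (by rw [Opens.chartAt_source]; trivial)
  exact h

theorem Opens.chartAt_symm_apply (x : U) {z : E} (hz : z ∈ U) :
    (chartAt E x).symm z = ⟨z, hz⟩ :=
  (chartAt E x).left_inv (x := ⟨z, hz⟩) (by rw [Opens.chartAt_source]; trivial)

theorem Opens.eventually_chartAt_symm (x y : U) :
    ∀ᶠ z in 𝓝 (y : E), ((chartAt E x).symm z : E) = z := by
  filter_upwards [U.isOpen.mem_nhds y.2] with z hz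
  rw [Opens.chartAt_symm_apply x hz]

variable [NormedSpace ℂ E]

theorem Opens.hasMFDerivAt_comp_val {G : Type*} [NormedAddCommGroup G] [NormedSpace ℝ G]
    {F : E → G} {F' : E →L[ℝ] G} {x : U} (hF : HasFDerivAt F F' x) :
    HasMFDerivAt 𝓘(ℝ, E) 𝓘(ℝ, G) (fun y : U => F y) x F' := by
  refine ⟨hF.continuousAt.comp continuous_subtype_val.continuousAt, ?_⟩
  have h : writtenInExtChartAt 𝓘(ℝ, E) 𝓘(ℝ, G) x (fun y : U => F y) =ᶠ[𝓝 (x : E)] F := by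
    filter_upwards [Opens.eventually_chartAt_symm x x] with z hz
    change F ((chartAt E x).symm z) = F z
    rw [hz]
  exact (hF.congr_of_eventuallyEq h).hasFDerivWithinAt

theorem Opens.hasMFDerivAt_of_coe {f : U → U} {F : E → E} {F' : E →L[ℝ] E} {x : U}
    (hf : ∀ y : U, (f y : E) = F y) (hF : HasFDerivAt F F' x) :
    HasMFDerivAt 𝓘(ℝ, E) 𝓘(ℝ, E) f x F' := by
  refine ⟨?_, ?_⟩
  · refine Topology.IsInducing.subtypeVal.continuousAt_iff.2 ?_
    change ContinuousAt (fun y : U => (f y : E)) x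
    simp only [hf]
    exact hF.continuousAt.comp continuous_subtype_val.continuousAt
  · have h : writtenInExtChartAt 𝓘(ℝ, E) 𝓘(ℝ, E) x f =ᶠ[𝓝 (x : E)] F := by
      filter_upwards [Opens.eventually_chartAt_symm x x] with z hz
      simp [writtenInExtChartAt, Opens.chartAt_apply, hf, hz]
    exact (hF.congr_of_eventuallyEq h).hasFDerivWithinAt

theorem Opens.hasMFDerivAt_chartAt (x y : U) :
    HasMFDerivAt 𝓘(ℝ, E) 𝓘(ℝ, E) (chartAt E x) y (ContinuousLinearMap.id ℝ E) :=
  Opens.hasMFDerivAt_comp_val (hasFDerivAt_id _)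

theorem Opens.hasMFDerivAt_chartAt_symm (x : U) {z : E} (hz : z ∈ U) :
    HasMFDerivAt 𝓘(ℝ, E) 𝓘(ℝ, E) (chartAt E x).symm z (ContinuousLinearMap.id ℝ E) := by
  refine ⟨(chartAt E x).symm.continuousAt (Opens.mem_chartAt_target hz), ?_⟩
  have h : writtenInExtChartAt 𝓘(ℝ, E) 𝓘(ℝ, E) z (chartAt E x).symm =ᶠ[𝓝 z] id := by
    filter_upwards [Opens.eventually_chartAt_symm x ⟨z, hz⟩] with w hw
    exact hw
  exact ((hasFDerivAt_id _).congr_of_eventuallyEq h).hasFDerivWithinAt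

theorem RealForm.inChart_of_coe {k : ℕ} {α : RealForm E U k} {θ : E → E [⋀^Fin k]→L[ℝ] ℝ}
    (h : ∀ y : U, α y = θ y) (x : U) {z : E} (hz : z ∈ U) : α.inChart x z = θ z := by
  unfold RealForm.inChart
  rw [(Opens.hasMFDerivAt_chartAt_symm x hz).mfderiv, h, Opens.chartAt_symm_apply x hz]
  rfl

/-- The charts of `U` are the inclusion, with identity differential, so the manifold exterior
derivative is the one of the ambient vector space. -/
theorem RealForm.d_of_coe {k : ℕ} {α : RealForm E U k} {θ : E → E [⋀^Fin k]→L[ℝ] ℝ}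
    (h : ∀ y : U, α y = θ y) (x : U) : α.d x = extDeriv θ x := by
  unfold RealForm.d
  have h1 : α.inChart x =ᶠ[𝓝 (x : E)] θ := by
    filter_upwards [U.isOpen.mem_nhds x.2] with z hz using RealForm.inChart_of_coe h x hz
  have h2 : extDeriv (α.inChart x) (chartAt E x x) = extDeriv θ x := by
    unfold extDeriv
    rw [Opens.chartAt_apply, h1.fderiv_eq]
  rw [(Opens.hasMFDerivAt_chartAt x x).mfderiv, h2]
  rfl

/-- The `1`-form `dᶜψ` of a real function on a complex vector space. -/
noncomputable def vectorSpaceDc (ψ : E → ℝ) (z : E) : E [⋀^Fin 1]→L[ℝ] ℝ :=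
  ContinuousAlternatingMap.ofSubsingleton ℝ E ℝ (0 : Fin 1) (-((fderiv ℝ ψ z).comp (mulI E)))

theorem dc_eq_vectorSpaceDc {ψ : E → ℝ} (hψ : ∀ z ∈ U, DifferentiableAt ℝ ψ z) (y : U) :
    dc (fun y : U => ψ y) y = vectorSpaceDc ψ y := by
  unfold dc
  rw [(Opens.hasMFDerivAt_comp_val (hψ y y.2).hasFDerivAt).mfderiv]
  rfl

theorem contDiffAt_vectorSpaceDc [FiniteDimensional ℝ E] {ψ : E → ℝ} {z : E}
    (hψ : ContDiffAt ℝ ∞ ψ z) : ContDiffAt ℝ ∞ (vectorSpaceDc ψ) z := by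
  let L : (E →L[ℝ] ℝ) →ₗ[ℝ] (E [⋀^Fin 1]→L[ℝ] ℝ) :=
    { toFun := fun f =>
        ContinuousAlternatingMap.ofSubsingleton ℝ E ℝ (0 : Fin 1) (-(f.comp (mulI E)))
      map_add' := fun f g => by ext v; simp; ring
      map_smul' := fun c f => by ext v; simp }
  exact L.toContinuousLinearMap.contDiff.contDiffAt.comp z
    (hψ.fderiv_right (m := ∞) (by simp))

/-- This identifies the complex Hessian, as a symmetric form, with the metric whose fundamental form
is `ddᶜψ`. The sign and normalization match those of `fundamentalForm`. -/
theorem extDeriv_vectorSpaceDc [FiniteDimensional ℝ E] {ψ : E → ℝ} {z : E}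
    (hψ : ContDiffAt ℝ ∞ ψ z) (v : Fin 2 → E) :
    extDeriv (vectorSpaceDc ψ) z v = complexHessian ψ z (Complex.I • v 0) (v 1) := by
  have hψ2 : ContDiffAt ℝ 2 ψ z := hψ.of_le (by norm_cast)
  have hd := hψ2.differentiableAt_fderiv
  have h (w : Fin 1 → E) (u : E) : fderiv ℝ (fun y => vectorSpaceDc ψ y w) z u =
      -fderiv ℝ (fderiv ℝ ψ) z u (Complex.I • w 0) := by
    change fderiv ℝ (fun y => -(fderiv ℝ ψ y (Complex.I • w 0))) z u = _
    rw [fderiv_fun_neg, fderiv_clm_apply hd (differentiableAt_const _)]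
    simp
  have hs : IsSymmSndFDerivAt ℝ ψ z := hψ2.isSymmSndFDerivAt (by simp)
  rw [extDeriv_apply ((contDiffAt_vectorSpaceDc hψ).differentiableAt (by simp)),
    Fin.sum_univ_two, h, h, complexHessian_apply, smul_smul, Complex.I_mul_I, hs (Complex.I • v 0)]
  simp [Fin.removeNth]
  ring

end OpenSubset

/-! ### Checking boundedness and smoothness of metrics. -/

section Metric

variable {E : Type*} [NormedAddCommGroup E] [NormedSpace ℂ E]
  {M : Type*} [TopologicalSpace M] [ChartedSpace E M] [IsManifold 𝓘(ℂ, E) ω M]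

/-- The minimum of the form on the compact unit sphere is positive, and homogeneity gives `δ ‖v‖² ≤
B v v`. -/
theorem isVonNBounded_of_posDef [FiniteDimensional ℝ E] {B : E →L[ℝ] E →L[ℝ] ℝ}
    (hB : ∀ v ≠ 0, 0 < B v v) : Bornology.IsVonNBounded ℝ {v : E | B v v < 1} := by
  rw [NormedSpace.isVonNBounded_iff']
  rcases subsingleton_or_nontrivial E with hE | hE
  · exact ⟨0, fun v _ => by rw [Subsingleton.elim v 0, norm_zero]⟩
  have hBc : Continuous fun v => B v v := by fun_prop
  obtain ⟨v₀, hv₀, hmin⟩ := (isCompact_sphere (0 : E) 1).exists_isMinOn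
    (NormedSpace.sphere_nonempty.2 zero_le_one) hBc.continuousOn
  have hv₀' : v₀ ≠ 0 := ne_zero_of_mem_unit_sphere ⟨v₀, hv₀⟩
  set δ := B v₀ v₀ with hδ
  have hδ0 : 0 < δ := hB v₀ hv₀'
  have key (v : E) : δ * ‖v‖ ^ 2 ≤ B v v := by
    by_cases hv : v = 0
    · simp [hv]
    have hn : 0 < ‖v‖ := norm_pos_iff.2 hv
    have h1 : δ ≤ B (‖v‖⁻¹ • v) (‖v‖⁻¹ • v) := hmin (by simp [norm_smul, hn.ne'])
    simp only [map_smul, smul_apply, smul_eq_mul] at h1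
    have h2 : B v v = ‖v‖ ^ 2 * (‖v‖⁻¹ * (‖v‖⁻¹ * B v v)) := by field_simp
    rw [h2, mul_comm δ]
    exact mul_le_mul_of_nonneg_left h1 (by positivity)
  refine ⟨√(1 / δ), fun v (hv : B v v < 1) => Real.le_sqrt_of_sq_le ?_⟩
  rw [le_div_iff₀ hδ0]
  linarith [key v]

/-- A field of bilinear forms is smooth if its expression in the chart at each point is. -/
theorem contMDiff_bilinearField
    {β : ∀ x : M, TangentSpace 𝓘(ℝ, E) x →L[ℝ] TangentSpace 𝓘(ℝ, E) x →L[ℝ] ℝ}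
    (h : ∀ x₀ : M, ∃ G : M → E →L[ℝ] E →L[ℝ] ℝ,
      ContMDiffAt 𝓘(ℝ, E) 𝓘(ℝ, E →L[ℝ] E →L[ℝ] ℝ) ∞ G x₀ ∧
      ∀ᶠ x in 𝓝 x₀, ∀ v w : E, β x
        (mfderiv 𝓘(ℝ, E) 𝓘(ℝ, E) (chartAt E x₀).symm (chartAt E x₀ x) v)
        (mfderiv 𝓘(ℝ, E) 𝓘(ℝ, E) (chartAt E x₀).symm (chartAt E x₀ x) w) = G x v w) :
    ContMDiff 𝓘(ℝ, E) (𝓘(ℝ, E).prod 𝓘(ℝ, E →L[ℝ] E →L[ℝ] ℝ)) ∞ (fun x : M =>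
      Bundle.TotalSpace.mk' (E →L[ℝ] E →L[ℝ] ℝ) (E := fun x : M =>
        TangentSpace 𝓘(ℝ, E) x →L[ℝ] TangentSpace 𝓘(ℝ, E) x →L[ℝ] ℝ) x (β x)) := by
  intro x₀
  obtain ⟨G, hG, hβ⟩ := h x₀
  rw [contMDiffAt_hom_bundle]
  refine ⟨contMDiffAt_id, hG.congr_of_eventuallyEq ?_⟩
  filter_upwards [hβ, (chartAt E x₀).open_source.mem_nhds (mem_chart_source E x₀)] with x hx hxs
  ext v w
  refine (inCoordinates_apply_eq₂ hxs hxs (Set.mem_univ _)).trans ?_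
  rw [← hx]
  have h1 := TangentBundle.symmL_trivializationAt (I := 𝓘(ℝ, E)) hxs
  simp only [extChartAt_coe, extChartAt_coe_symm, modelWithCornersSelf_coe,
    modelWithCornersSelf_coe_symm, Set.range_id, mfderivWithin_univ, Function.id_comp,
    Function.comp_id] at h1
  have h2 (u : E) : (trivializationAt E (TangentSpace 𝓘(ℝ, E)) x₀).symm x u =
      mfderiv 𝓘(ℝ, E) 𝓘(ℝ, E) (chartAt E x₀).symm (chartAt E x₀ x) u :=
    (Bundle.Trivialization.symmL_apply (R := ℝ) _ hxs u).symm.trans (DFunLike.congr_fun h1 u)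
  rw [h2, h2]
  simp

end Metric

/-! ### Charts and differential of the quotient projection. -/

section QuotientManifold

open MulAction

/-- The representative of `q` which defines the preferred chart at `q`. -/
noncomputable def quotientRep {X G : Type*} [Group G] [MulAction G X]
    (q : orbitRel.Quotient G X) : X :=
  (Quotient.mk_surjective (s := orbitRel G X)).hasRightInverse.choose q

theorem mk_quotientRep {X G : Type*} [Group G] [MulAction G X] (q : orbitRel.Quotient G X) :
    Quotient.mk (orbitRel G X) (quotientRep q) = q :=
  (Quotient.mk_surjective (s := orbitRel G X)).hasRightInverse.choose_spec q

theorem exists_smul_eq_quotientRep {X G : Type*} [Group G] [MulAction G X] (y : X) :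
    ∃ g : G, g • y = quotientRep (Quotient.mk (orbitRel G X) y) :=
  Quotient.exact (mk_quotientRep (Quotient.mk (orbitRel G X) y))

variable {𝕜 : Type*} [NontriviallyNormedField 𝕜]
    {E : Type*} [NormedAddCommGroup E] [NormedSpace 𝕜 E]
    {X : Type*} [TopologicalSpace X] [ChartedSpace E X]
    {G : Type*} [Group G] [MulAction G X]
    [ProperlyDiscontinuousSMul G X] [ContinuousConstSMul G X] [IsCancelSMul G X]
    [T2Space X] [LocallyCompactSpace X]

variable (X G) in
theorem isCoveringMap_quotientMk :
    IsCoveringMap (Quotient.mk (orbitRel G X)) :=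
  (isQuotientCoveringMap_quotientMk_of_properlyDiscontinuousSMul (G := G)
    (E := X)).isCoveringMap

/-- The section of the projection through the point `x`. -/
noncomputable def quotientSection (x : X) : OpenPartialHomeomorph (orbitRel.Quotient G X) X :=
  (isCoveringMap_quotientMk X G).isLocalHomeomorph.localInverseAt x

theorem quotientSection_symm (x : X) :
    ((quotientSection (G := G) x).symm : X → orbitRel.Quotient G X) = Quotient.mk (orbitRel G X) :=
  (isCoveringMap_quotientMk X G).isLocalHomeomorph.localInverseAt_symm x

theorem mem_quotientSection_target (x : X) : x ∈ (quotientSection (G := G) x).target :=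
  (isCoveringMap_quotientMk X G).isLocalHomeomorph.self_mem_localInverseAt_target

theorem mk_quotientSection {x : X} {q : orbitRel.Quotient G X}
    (hq : q ∈ (quotientSection (G := G) x).source) :
    Quotient.mk (orbitRel G X) (quotientSection x q) = q :=
  (isCoveringMap_quotientMk X G).isLocalHomeomorph.apply_localInverseAt_of_mem hq

theorem chartAt_quotient (q : orbitRel.Quotient G X) :
    chartAt E q = (quotientSection (quotientRep q)).trans (chartAt E (quotientRep q)) := rfl

/-- Near a point `y` in the orbit of `x`, the section through `x` composed with the projection is
a translation. -/
theorem eventually_quotientSection_mk {x y : X} {g : G}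
    (hg : g • y ∈ (quotientSection (G := G) x).target) :
    ∀ᶠ w in 𝓝 y, quotientSection x (Quotient.mk (orbitRel G X) w) = g • w := by
  have h1 : ∀ᶠ w in 𝓝 y, g • w ∈ (quotientSection (G := G) x).target :=
    (continuous_const_smul g).continuousAt.eventually_mem
      ((quotientSection (G := G) x).open_target.mem_nhds hg)
  filter_upwards [h1] with w hw
  have h2 : Quotient.mk (orbitRel G X) w = Quotient.mk (orbitRel G X) (g • w) :=
    (Quotient.sound (show (orbitRel G X).r _ _ from ⟨g, rfl⟩)).symm
  have h3 := (quotientSection (G := G) x).right_inv hw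
  rwa [quotientSection_symm, ← h2] at h3

theorem exists_smul_mem_quotientSection_target {x y : X}
    (h : Quotient.mk (orbitRel G X) y ∈ (quotientSection (G := G) x).source) :
    ∃ g : G, g • y = quotientSection (G := G) x (Quotient.mk (orbitRel G X) y) ∧
      g • y ∈ (quotientSection (G := G) x).target := by
  obtain ⟨g, hg⟩ : quotientSection (G := G) x (Quotient.mk (orbitRel G X) y) ∈ orbit G y :=
    Quotient.exact (mk_quotientSection h)
  have hg : g • y = _ := hg
  exact ⟨g, hg, hg ▸ (quotientSection (G := G) x).map_source h⟩

theorem chartAt_quotient_source_subset (q : orbitRel.Quotient G X) :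
    (chartAt E q).source ⊆ (quotientSection (G := G) (quotientRep q)).source := fun _ h => h.1

variable {n : ℕ∞ω}

theorem quotientRep_mem_target (q : orbitRel.Quotient G X) :
    quotientRep q ∈ (quotientSection (G := G) (quotientRep q)).target :=
  mem_quotientSection_target _

theorem contMDiff_quotientMk [IsManifold 𝓘(𝕜, E) n X]
    (hG : ∀ g : G, ContMDiff 𝓘(𝕜, E) 𝓘(𝕜, E) n (fun x : X => g • x)) :
    ContMDiff 𝓘(𝕜, E) 𝓘(𝕜, E) n (Quotient.mk (orbitRel G X)) := by
  have := isManifold_orbitRel_quotient n hG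
  intro y
  set q := Quotient.mk (orbitRel G X) y with hq
  obtain ⟨g, hg⟩ := exists_smul_eq_quotientRep (G := G) y
  have hgt : g • y ∈ (quotientSection (G := G) (quotientRep q)).target :=
    hg ▸ quotientRep_mem_target q
  have h1 : ContMDiffAt 𝓘(𝕜, E) 𝓘(𝕜, E) n
      (fun w => chartAt E (quotientRep q) (g • w)) y := by
    refine ContMDiffAt.comp y ?_ (hG g).contMDiffAt
    exact (contMDiffOn_chart (I := 𝓘(𝕜, E)) (n := n)).contMDiffAt
      ((chartAt E _).open_source.mem_nhds (by rw [hg]; exact mem_chart_source E _))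
  have h2 : (chartAt E q) ∘ Quotient.mk (orbitRel G X) =ᶠ[𝓝 y]
      fun w => chartAt E (quotientRep q) (g • w) := by
    filter_upwards [eventually_quotientSection_mk hgt] with w hw
    simp [chartAt_quotient, hw]
  have h3 : ContMDiffAt 𝓘(𝕜, E) 𝓘(𝕜, E) n
      ((chartAt E q).symm ∘ (chartAt E q) ∘ Quotient.mk (orbitRel G X)) y := by
    refine ContMDiffAt.comp y ?_ (h1.congr_of_eventuallyEq h2)
    exact (contMDiffOn_chart_symm (I := 𝓘(𝕜, E)) (n := n)).contMDiffAt
      ((chartAt E q).open_target.mem_nhds (mem_chart_target E q))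
  refine h3.congr_of_eventuallyEq ?_
  filter_upwards [continuous_quotient_mk'.continuousAt.eventually_mem
    ((chartAt E q).open_source.mem_nhds (mem_chart_source E q))] with w hw
  exact ((chartAt E q).left_inv hw).symm

/-- Near any point of its domain the section differs from the one defining the preferred chart by a
translation `g`, which is smooth. -/
theorem contMDiffOn_quotientSection [IsManifold 𝓘(𝕜, E) n X]
    (hG : ∀ g : G, ContMDiff 𝓘(𝕜, E) 𝓘(𝕜, E) n (fun x : X => g • x)) (x : X) :
    ContMDiffOn 𝓘(𝕜, E) 𝓘(𝕜, E) n (quotientSection (G := G) x)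
      (quotientSection (G := G) x).source := by
  have := isManifold_orbitRel_quotient n hG
  intro q hq
  refine ContMDiffAt.contMDiffWithinAt ?_
  obtain ⟨a, ha⟩ : ∃ a, quotientRep q = a := ⟨_, rfl⟩
  have haq : Quotient.mk (orbitRel G X) a = q := ha ▸ mk_quotientRep q
  obtain ⟨g, -, hgt⟩ := exists_smul_mem_quotientSection_target (x := x) (y := a) (haq.symm ▸ hq)
  have hea : chartAt E q q = chartAt E a a := by
    rw [chartAt_quotient, ha, OpenPartialHomeomorph.coe_trans, Function.comp_apply]
    congr 1
    conv_lhs => rw [← haq]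
    exact (isCoveringMap_quotientMk X G).isLocalHomeomorph.localInverseAt_apply_self
  have h1 : ContMDiffAt 𝓘(𝕜, E) 𝓘(𝕜, E) n (fun z => g • (chartAt E a).symm z)
      (chartAt E q q) := by
    rw [hea]
    refine (hG g).contMDiffAt.comp _ ?_
    exact (contMDiffOn_chart_symm (I := 𝓘(𝕜, E)) (n := n)).contMDiffAt
      ((chartAt E a).open_target.mem_nhds (mem_chart_target E a))
  have h2 : (fun z => quotientSection x ((chartAt E q).symm z)) =ᶠ[𝓝 (chartAt E q q)]
      fun z => g • (chartAt E a).symm z := by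
    rw [hea]
    have hc := (chartAt E a).symm.continuousAt (mem_chart_target E a)
    have h := eventually_quotientSection_mk (x := x) (y := a) hgt
    rw [← (chartAt E a).left_inv (mem_chart_source E a)] at h
    filter_upwards [hc.eventually h] with z hz
    rw [chartAt_quotient, ha, OpenPartialHomeomorph.trans_symm_eq_symm_trans_symm,
      OpenPartialHomeomorph.coe_trans, Function.comp_apply, quotientSection_symm, hz]
  have h3 := (h1.congr_of_eventuallyEq h2).comp q
    ((contMDiffOn_chart (I := 𝓘(𝕜, E)) (n := n)).contMDiffAt
      ((chartAt E q).open_source.mem_nhds (mem_chart_source E q)))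
  refine h3.congr_of_eventuallyEq ?_
  filter_upwards [(chartAt E q).open_source.mem_nhds (mem_chart_source E q)] with p hp
  simp [(chartAt E q).left_inv hp]

theorem isLocalDiffeomorph_quotientMk [IsManifold 𝓘(𝕜, E) n X]
    (hG : ∀ g : G, ContMDiff 𝓘(𝕜, E) 𝓘(𝕜, E) n (fun x : X => g • x)) :
    IsLocalDiffeomorph 𝓘(𝕜, E) 𝓘(𝕜, E) n (Quotient.mk (orbitRel G X)) := fun x =>
  ⟨{ (quotientSection (G := G) x).symm with
      contMDiffOn_toFun := by
        change ContMDiffOn _ _ n (quotientSection (G := G) x).symm _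
        rw [quotientSection_symm]
        exact (contMDiff_quotientMk hG).contMDiffOn
      contMDiffOn_invFun := contMDiffOn_quotientSection hG x },
    mem_quotientSection_target x, fun y _ => congrFun (quotientSection_symm x).symm y⟩

/-- The preferred chart at the image of `y` is the section through `g • y` followed by the chart
there. Read in charts, the projection near `y` is therefore the translation by `g`. -/
theorem hasMFDerivAt_quotientMk {y : X} {g : G}
    (hg : g • y = quotientRep (Quotient.mk (orbitRel G X) y)) {D : E →L[𝕜] E}
    (hD : HasMFDerivAt 𝓘(𝕜, E) 𝓘(𝕜, E) (fun x : X => g • x) y D) :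
    HasMFDerivAt 𝓘(𝕜, E) 𝓘(𝕜, E) (Quotient.mk (orbitRel G X)) y D := by
  refine ⟨continuous_quotient_mk'.continuousAt, ?_⟩
  have hgt : g • y ∈ (quotientSection (G := G) (g • y)).target := mem_quotientSection_target _
  have hc := (chartAt E y).symm.continuousAt (mem_chart_target E y)
  have h := eventually_quotientSection_mk hgt
  rw [← (chartAt E y).left_inv (mem_chart_source E y)] at h
  have hev : writtenInExtChartAt 𝓘(𝕜, E) 𝓘(𝕜, E) y (Quotient.mk (orbitRel G X))
      =ᶠ[𝓝 (chartAt E y y)] writtenInExtChartAt 𝓘(𝕜, E) 𝓘(𝕜, E) y (fun x : X => g • x) := by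
    filter_upwards [hc.eventually h] with z hz
    change chartAt E (Quotient.mk (orbitRel G X) y) (Quotient.mk (orbitRel G X) _) =
      chartAt E (g • y) (g • (chartAt E y).symm z)
    rw [chartAt_quotient, ← hg, OpenPartialHomeomorph.coe_trans, Function.comp_apply]
    congr 1
    rw [(chartAt E y).left_inv (mem_chart_source E y)] at hz
    exact hz
  exact hD.2.congr_of_eventuallyEq (hev.filter_mono nhdsWithin_le_nhds) hev.self_of_nhds

end QuotientManifold

/-! ### Descent of an invariant field of bilinear forms. -/

section QuotientMetric

open MulAction TopologicalSpace

variable {E : Type*} [NormedAddCommGroup E] [NormedSpace ℂ E] {U : Opens E}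
    {G : Type*} [Group G] [MulAction G U]
    [ProperlyDiscontinuousSMul G U] [ContinuousConstSMul G U] [IsCancelSMul G U]
    [LocallyCompactSpace U]

/-- The tangent space at `q` is read through `quotientRep q`, which may jump with `q`. Invariance
absorbs the jumps: in one fixed chart the field is simply `β`. -/
theorem contMDiff_quotient_bilinearField [IsManifold 𝓘(ℂ, E) ω (orbitRel.Quotient G U)]
    (hG : ∀ g : G, MDifferentiable 𝓘(ℝ, E) 𝓘(ℝ, E) (fun x : U => g • x))
    {β : E → E →L[ℝ] E →L[ℝ] ℝ} (hβ : ∀ z ∈ U, ContDiffAt ℝ ∞ β z)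
    (hinv : ∀ (g : G) (y : U) (v w : E),
      β (g • y : U) (mfderiv 𝓘(ℝ, E) 𝓘(ℝ, E) (fun x : U => g • x) y v)
        (mfderiv 𝓘(ℝ, E) 𝓘(ℝ, E) (fun x : U => g • x) y w) = β y v w) :
    ContMDiff 𝓘(ℝ, E) (𝓘(ℝ, E).prod 𝓘(ℝ, E →L[ℝ] E →L[ℝ] ℝ)) ∞
      (fun q : orbitRel.Quotient G U =>
      Bundle.TotalSpace.mk' (E →L[ℝ] E →L[ℝ] ℝ) (E := fun q : orbitRel.Quotient G U =>
        TangentSpace 𝓘(ℝ, E) q →L[ℝ] TangentSpace 𝓘(ℝ, E) q →L[ℝ] ℝ) q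
        (β (quotientRep q : U))) := by
  refine contMDiff_bilinearField fun q₀ => ⟨fun q => β (chartAt E q₀ q), ?_, ?_⟩
  · have h1 : ContMDiffAt 𝓘(ℝ, E) 𝓘(ℝ, E) ∞ (chartAt E q₀) q₀ :=
      (contMDiffOn_chart (I := 𝓘(ℝ, E)) (n := ∞)).contMDiffAt
        ((chartAt E q₀).open_source.mem_nhds (mem_chart_source E q₀))
    exact ContMDiffAt.comp q₀ (hβ _ (Subtype.property _)).contMDiffAt h1
  · filter_upwards [(chartAt E q₀).open_source.mem_nhds (mem_chart_source E q₀)] with q hq v w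
    set a := quotientRep q₀ with ha
    set y : U := quotientSection a q with hy
    have hyq : Quotient.mk (orbitRel G U) y = q :=
      mk_quotientSection (chartAt_quotient_source_subset _ hq)
    have hcy : chartAt E q₀ q = y := rfl
    obtain ⟨g, hg⟩ := exists_smul_eq_quotientRep (G := G) y
    have hπ := hasMFDerivAt_quotientMk (𝕜 := ℝ) hg ((hG g) y).hasMFDerivAt
    have hs := Opens.hasMFDerivAt_chartAt_symm a y.2
    have hsy : (chartAt E a).symm y = y := Opens.chartAt_symm_apply a y.2
    have hfun : ((chartAt E q₀).symm : E → orbitRel.Quotient G U) =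
        Quotient.mk (orbitRel G U) ∘ (chartAt E a).symm := by
      rw [chartAt_quotient, OpenPartialHomeomorph.trans_symm_eq_symm_trans_symm,
        OpenPartialHomeomorph.coe_trans, quotientSection_symm]
    set D : E →L[ℝ] E := mfderiv 𝓘(ℝ, E) 𝓘(ℝ, E) (fun x : U => g • x) y with hD
    have hπ' : HasMFDerivAt 𝓘(ℝ, E) 𝓘(ℝ, E) (Quotient.mk (orbitRel G U))
        ((chartAt E a).symm y) D := by
      rw [hsy]
      exact hπ
    have hcomp : HasMFDerivAt 𝓘(ℝ, E) 𝓘(ℝ, E) (chartAt E q₀).symm (y : E) D := by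
      rw [hfun]
      exact hπ'.comp (y : E) hs
    rw [hcy, hcomp.mfderiv, ← hinv g y v w, hg, hyq]
    rfl

end QuotientMetric

/-! ### The Kähler metric of a potential. -/

section PotentialMetric

open TopologicalSpace

variable {E : Type*} [NormedAddCommGroup E] [NormedSpace ℂ E]

theorem contDiffAt_complexHessian {ψ : E → ℝ} {z : E} (hψ : ContDiffAt ℝ ∞ ψ z) :
    ContDiffAt ℝ ∞ (complexHessian ψ) z := by
  have hD : ContDiffAt ℝ ∞ (fderiv ℝ (fderiv ℝ ψ)) z :=
    (hψ.fderiv_right (m := ∞) (by simp)).fderiv_right (m := ∞) (by simp)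
  exact hD.add (contDiffAt_const (c := (ContinuousLinearMap.compL ℝ E E ℝ).flip (mulI E))
    |>.clm_comp (hD.clm_comp contDiffAt_const))

/-- The form `ψ⁻¹ ddᶜψ`, as a field of symmetric bilinear forms. -/
noncomputable def rescaledHessian (ψ : E → ℝ) (z : E) : E →L[ℝ] E →L[ℝ] ℝ :=
  (ψ z)⁻¹ • complexHessian ψ z

theorem rescaledHessian_apply (ψ : E → ℝ) (z v w : E) :
    rescaledHessian ψ z v w = (ψ z)⁻¹ * complexHessian ψ z v w := rfl

theorem ContDiffAt.real_smul {F G : Type*} [NormedAddCommGroup F] [NormedSpace ℝ F]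
    [NormedAddCommGroup G] [NormedSpace ℝ G] {m : WithTop ℕ∞} {f : F → ℝ} {g : F → G} {z : F}
    (hf : ContDiffAt ℝ m f z) (hg : ContDiffAt ℝ m g z) :
    ContDiffAt ℝ m (fun y => f y • g y) z := hf.smul hg

theorem contDiffAt_rescaledHessian {ψ : E → ℝ} {z : E} (hψ : ContDiffAt ℝ ∞ ψ z)
    (hz : ψ z ≠ 0) : ContDiffAt ℝ ∞ (rescaledHessian ψ) z :=
  (hψ.inv hz).real_smul (contDiffAt_complexHessian hψ)

variable [FiniteDimensional ℝ E] {U : Opens E}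

/-- The Kähler metric with Kähler potential `ψ`. -/
noncomputable def potentialMetric (ψ : E → ℝ) (hψ : ∀ z ∈ U, ContDiffAt ℝ ∞ ψ z)
    (hpos : ∀ z ∈ U, ∀ v ≠ 0, 0 < complexHessian ψ z v v) : HermitianMetric E U where
  inner x := complexHessian (E := E) ψ x
  symm x v w := complexHessian_symm ((hψ x x.2).of_le (by norm_cast)) v w
  pos x v hv := hpos x x.2 v hv
  isVonNBounded x := isVonNBounded_of_posDef (E := E) (hpos x x.2)
  contMDiff := by
    refine contMDiff_bilinearField fun x₀ => ⟨fun x => complexHessian ψ x, ?_, ?_⟩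
    · exact ContMDiffAt.comp x₀ (contDiffAt_complexHessian (hψ x₀ x₀.2)).contMDiffAt
        contMDiff_subtype_val.contMDiffAt
    · refine Filter.Eventually.of_forall fun x v w => ?_
      rw [Opens.chartAt_apply, (Opens.hasMFDerivAt_chartAt_symm x₀ x.2).mfderiv]
      rfl
  inner_complexJ x v w := complexHessian_I_smul ψ x v w

variable {ψ : E → ℝ} {hψ : ∀ z ∈ U, ContDiffAt ℝ ∞ ψ z}
  {hpos : ∀ z ∈ U, ∀ v ≠ 0, 0 < complexHessian ψ z v v}

theorem fundamentalForm_potentialMetric (x : U) :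
    (potentialMetric ψ hψ hpos).fundamentalForm x = extDeriv (vectorSpaceDc ψ) x := by
  ext v
  exact (extDeriv_vectorSpaceDc (hψ x x.2) v).symm

theorem isKahlerPotential_potentialMetric :
    (potentialMetric ψ hψ hpos).IsKahlerPotential (fun x => ψ x) := by
  refine ⟨fun x => ContMDiffAt.comp x (hψ x x.2).contMDiffAt
    contMDiff_subtype_val.contMDiffAt, funext fun x => ?_⟩
  rw [fundamentalForm_potentialMetric, RealForm.d_of_coe
    (dc_eq_vectorSpaceDc fun z hz => (hψ z hz).differentiableAt (by simp))]

theorem isKahler_potentialMetric : (potentialMetric ψ hψ hpos).IsKahler := by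
  funext x
  rw [RealForm.d_of_coe fundamentalForm_potentialMetric, extDeriv_extDeriv_apply
    (contDiffAt_vectorSpaceDc (hψ x x.2))
    (by simp only [minSmoothness_of_isRCLikeNormedField]; norm_cast)]
  rfl

end PotentialMetric

/-! ### The covering of the Hopf manifold, its deck group and its metric. -/

section HopfMetric

open MulAction TopologicalSpace

variable {n : ℕ} {γ : EuclideanSpace ℂ (Fin n) ≃ₘ^ω⟮𝓘(ℂ, EuclideanSpace ℂ (Fin n)),
    𝓘(ℂ, EuclideanSpace ℂ (Fin n))⟯ EuclideanSpace ℂ (Fin n)} {hγ : IsContraction γ 0}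

variable (hγ) in
theorem coe_puncturedPerm_zpow (k : ℤ) (x : puncturedSpace n) :
    (((puncturedPerm γ.toEquiv hγ.map_center) ^ k) x : EuclideanSpace ℂ (Fin n)) =
      ((γ.toEquiv : Equiv.Perm _) ^ k) x := by
  cases k with
  | ofNat k =>
    rw [Int.ofNat_eq_natCast, zpow_natCast, zpow_natCast, coe_puncturedPerm_pow (hγ := hγ),
      ← Equiv.Perm.iterate_eq_pow]
    rfl
  | negSucc k =>
    rw [zpow_negSucc, zpow_negSucc, Equiv.Perm.eq_inv_iff_eq]
    obtain ⟨y, rfl⟩ := ((puncturedPerm γ.toEquiv hγ.map_center) ^ (k + 1)).surjective x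
    rw [show (((puncturedPerm γ.toEquiv hγ.map_center) ^ (k + 1))⁻¹)
      (((puncturedPerm γ.toEquiv hγ.map_center) ^ (k + 1)) y) = y from
      Equiv.symm_apply_apply _ _, coe_puncturedPerm_pow (hγ := hγ), ← Equiv.Perm.iterate_eq_pow]
    rfl

theorem exists_zpow_of_hopfGroup (g : hopfGroup γ hγ) :
    ∃ k : ℤ, ∀ x : puncturedSpace n,
      ((g • x : puncturedSpace n) : EuclideanSpace ℂ (Fin n)) =
        ((γ.toEquiv : Equiv.Perm _) ^ k) x := by
  obtain ⟨_, k, rfl⟩ := g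
  exact ⟨k, coe_puncturedPerm_zpow hγ k⟩

/-- For `n ≥ 1` the real dimension `2n` exceeds `1`, so removing a point does not disconnect; for `n
= 0` the space is empty. -/
theorem preconnectedSpace_puncturedSpace : PreconnectedSpace (puncturedSpace n) := by
  rcases Nat.eq_zero_or_pos n with rfl | hn
  · have : IsEmpty (puncturedSpace 0) := ⟨fun x => x.2 (Subsingleton.elim _ _)⟩
    infer_instance
  · have : Nonempty (Fin n) := ⟨⟨0, hn⟩⟩
    have h : 1 < Module.rank ℝ (EuclideanSpace ℂ (Fin n)) := by
      rw [← Module.finrank_eq_rank, Nat.one_lt_cast, finrank_real_of_complex,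
        finrank_euclideanSpace_fin]
      omega
    exact Subtype.preconnectedSpace
      (isConnected_compl_singleton_of_one_lt_rank h 0).isPreconnected

/-- The projection of `ℂⁿ ∖ 0` to the Hopf manifold. -/
def hopfProj (γ : EuclideanSpace ℂ (Fin n) ≃ₘ^ω⟮𝓘(ℂ, EuclideanSpace ℂ (Fin n)),
    𝓘(ℂ, EuclideanSpace ℂ (Fin n))⟯ EuclideanSpace ℂ (Fin n)) (hγ : IsContraction γ 0) :
    puncturedSpace n → HopfManifold γ hγ :=
  Quotient.mk (orbitRel (hopfGroup γ hγ) (puncturedSpace n))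

theorem isGaloisHolomorphicCovering_hopfProj :
    IsGaloisHolomorphicCovering (EuclideanSpace ℂ (Fin n)) (hopfProj γ hγ) where
  isCoveringMap := isCoveringMap_quotientMk _ _
  surjective := Quotient.mk_surjective
  isLocalDiffeomorph := isLocalDiffeomorph_quotientMk contMDiff_hopfGroup_smul
  preconnectedSpace := preconnectedSpace_puncturedSpace
  exists_deck := by
    intro y y' h
    obtain ⟨g, hg⟩ : y' ∈ orbit (hopfGroup γ hγ) y := Quotient.exact h.symm
    exact ⟨Homeomorph.smul g, fun x => Quotient.sound ⟨g, rfl⟩, hg⟩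

/-- The deck transformations of `ℂⁿ ∖ 0` over the Hopf manifold are the powers of `γ`. -/
theorem IsDeckTransformation.exists_smul {φ : puncturedSpace n ≃ₜ puncturedSpace n}
    (hφ : IsDeckTransformation (hopfProj γ hγ) φ) :
    ∃ g : hopfGroup γ hγ, (φ : puncturedSpace n → puncturedSpace n) = fun x => g • x := by
  rcases isEmpty_or_nonempty (puncturedSpace n) with h | ⟨⟨y⟩⟩
  · exact ⟨1, funext fun x => h.elim x⟩
  · obtain ⟨g, hg⟩ : φ y ∈ orbit (hopfGroup γ hγ) y := Quotient.exact (hφ y)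
    have := preconnectedSpace_puncturedSpace (n := n)
    -- Uniqueness of lifts: `φ` and the translation by `g` both lift the projection and agree at
    -- `y`.
    refine ⟨g, (isCoveringMap_quotientMk _ (hopfGroup γ hγ)).eq_of_comp_eq φ.continuous
      (continuous_const_smul g) (funext fun x => ?_) y hg.symm⟩
    exact (hφ x).trans (Quotient.sound (show (orbitRel _ _).r _ _ from ⟨g, rfl⟩)).symm

variable {c : ℝ} {ψ : EuclideanSpace ℂ (Fin n) → ℝ}

theorem apply_zpow_of_automorphic {V : Type*} [Zero V] {T : Equiv.Perm V} (h0 : T 0 = 0)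
    {ψ : V → ℝ} (hc : 0 < c) (hψT : ∀ z ≠ 0, ψ (T z) = c * ψ z) (k : ℤ) {z : V} (hz : z ≠ 0) :
    ψ ((T ^ k) z) = c ^ k * ψ z := by
  have hne (k : ℤ) : (T ^ k) z ≠ 0 := by
    have h : (T ^ k) 0 = 0 := Function.IsFixedPt.perm_zpow h0 k
    intro h'
    exact hz ((T ^ k).injective (h'.trans h.symm))
  have hstep (k : ℤ) : ψ ((T ^ (k + 1)) z) = c * ψ ((T ^ k) z) := by
    rw [add_comm, zpow_add, zpow_one, Equiv.Perm.mul_apply, hψT _ (hne k)]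
  induction k with
  | zero => simp
  | succ k ih => rw [hstep, ih, zpow_add_one₀ hc.ne']; ring
  | pred k ih =>
    have h := hstep (-k - 1)
    rw [sub_add_cancel, ih] at h
    rw [zpow_sub_one₀ hc.ne']
    field_simp
    linarith

theorem hasMFDerivAt_hopfGroup_smul {g : hopfGroup γ hγ} {k : ℤ}
    (hk : ∀ x : puncturedSpace n, ((g • x : puncturedSpace n) : EuclideanSpace ℂ (Fin n)) =
        ((γ.toEquiv : Equiv.Perm _) ^ k) x) (y : puncturedSpace n) :
    HasMFDerivAt 𝓘(ℝ, EuclideanSpace ℂ (Fin n)) 𝓘(ℝ, EuclideanSpace ℂ (Fin n))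
      (fun x : puncturedSpace n => g • x) y
      (fderiv ℝ (E := EuclideanSpace ℂ (Fin n))
        ((γ.toEquiv : Equiv.Perm _) ^ k : Equiv.Perm (EuclideanSpace ℂ (Fin n))) y) :=
  Opens.hasMFDerivAt_of_coe hk
    (((contDiff_zpow γ.contMDiff_toFun.contDiff γ.contMDiff_invFun.contDiff k).differentiable
      (by simp)).restrictScalars ℝ).differentiableAt.hasFDerivAt

/-- Automorphy of `ψ` holds on a neighbourhood of `z`, so it can be differentiated twice; `γ^k`
being holomorphic, it acts on the complex Hessian by pullback. -/
theorem complexHessian_zpow (hc : 0 < c) (hψ : ∀ z ≠ 0, ContDiffAt ℝ ∞ ψ z)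
    (h0 : γ 0 = 0) (hψT : ∀ z ≠ 0, ψ (γ z) = c * ψ z) (k : ℤ) {z : EuclideanSpace ℂ (Fin n)}
    (hz : z ≠ 0) (v w : EuclideanSpace ℂ (Fin n)) :
    complexHessian ψ (((γ.toEquiv : Equiv.Perm _) ^ k) z)
      (fderiv ℝ ((γ.toEquiv : Equiv.Perm _) ^ k : Equiv.Perm (EuclideanSpace ℂ (Fin n))) z v)
      (fderiv ℝ ((γ.toEquiv : Equiv.Perm _) ^ k : Equiv.Perm (EuclideanSpace ℂ (Fin n))) z w) =
      c ^ k * complexHessian ψ z v w := by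
  have hne : ((γ.toEquiv : Equiv.Perm _) ^ k) z ≠ 0 := by
    have h : ((γ.toEquiv : Equiv.Perm _) ^ k) 0 = 0 := Function.IsFixedPt.perm_zpow h0 k
    intro h'
    exact hz (((γ.toEquiv : Equiv.Perm _) ^ k).injective (h'.trans h.symm))
  have h2 : (2 : WithTop ℕ∞) ≤ ∞ := by norm_cast
  rw [← complexHessian_comp ((hψ _ hne).of_le h2)
    ((contDiff_zpow γ.contMDiff_toFun.contDiff γ.contMDiff_invFun.contDiff k).of_le
      le_top).contDiffAt]
  have hev : (fun y => ψ (((γ.toEquiv : Equiv.Perm _) ^ k) y)) =ᶠ[𝓝 z] fun y => c ^ k * ψ y := by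
    filter_upwards [isOpen_compl_singleton.mem_nhds hz] with y hy
    exact apply_zpow_of_automorphic (T := γ.toEquiv) h0 hc hψT k hy
  rw [complexHessian_congr hev, complexHessian_const_mul ((hψ z hz).of_le h2)]
  rfl

/-- The metric on the Hopf manifold induced by the conformally rescaled metric
`ψ⁻¹ ddᶜψ` on `ℂⁿ ∖ 0`. -/
noncomputable def hopfMetric (hc : 0 < c) (hψ : ∀ z ≠ 0, ContDiffAt ℝ ∞ ψ z)
    (hpos : ∀ z ≠ 0, 0 < ψ z) (hψT : ∀ z ≠ 0, ψ (γ z) = c * ψ z)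
    (hpsh : ∀ z ≠ 0, ∀ v ≠ 0, 0 < complexHessian ψ z v v) :
    HermitianMetric (EuclideanSpace ℂ (Fin n)) (HopfManifold γ hγ) where
  inner q := rescaledHessian (E := EuclideanSpace ℂ (Fin n)) ψ (quotientRep q : puncturedSpace n)
  symm q v w := congrArg (_ * ·)
    (complexHessian_symm ((hψ _ (quotientRep q).2).of_le (by norm_cast)) v w)
  pos q v hv := mul_pos (inv_pos.2 (hpos _ (quotientRep q).2))
    (hpsh _ (quotientRep q).2 v hv)
  isVonNBounded q := isVonNBounded_of_posDef (E := EuclideanSpace ℂ (Fin n)) fun v hv =>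
    mul_pos (inv_pos.2 (hpos _ (quotientRep q).2)) (hpsh _ (quotientRep q).2 v hv)
  contMDiff := by
    refine contMDiff_quotient_bilinearField (β := rescaledHessian ψ)
      (fun g y => ?_) (fun z hz => ?_) fun g y v w => ?_
    · obtain ⟨k, hk⟩ := exists_zpow_of_hopfGroup g
      exact (hasMFDerivAt_hopfGroup_smul hk y).mdifferentiableAt
    · exact contDiffAt_rescaledHessian (hψ z hz) (hpos z hz).ne'
    · obtain ⟨k, hk⟩ := exists_zpow_of_hopfGroup g
      have hck : c ^ k ≠ 0 := (zpow_pos hc k).ne'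
      rw [(hasMFDerivAt_hopfGroup_smul hk y).mfderiv, hk]
      -- The factor `c ^ k` from the Hessian cancels against the one from `ψ⁻¹`.
      refine (congrArg (_ * ·)
        (complexHessian_zpow hc hψ hγ.map_center hψT k y.2 v w)).trans ?_
      rw [apply_zpow_of_automorphic (T := γ.toEquiv) hγ.map_center hc hψT k y.2,
        rescaledHessian_apply]
      field_simp
  inner_complexJ q v w := congrArg (_ * ·) (complexHessian_I_smul ψ _ v w)

end HopfMetric

/-! ### Assembly of the potential, the covering and the metrics. -/

theorem mainTheorem1 (n : ℕ)
    (γ : EuclideanSpace ℂ (Fin n) ≃ₘ^ω⟮𝓘(ℂ, EuclideanSpace ℂ (Fin n)),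
      𝓘(ℂ, EuclideanSpace ℂ (Fin n))⟯ EuclideanSpace ℂ (Fin n))
    (hγ : IsContraction γ 0) :
    ∃ h : HermitianMetric (EuclideanSpace ℂ (Fin n)) (HopfManifold γ hγ),
      h.IsLCKWithPotential := by
  obtain ⟨c, ψ, hc, hψ, hpos, hψT, hpsh⟩ := exists_automorphic_potential (T := γ.toEquiv)
    γ.contMDiff_toFun.contDiff γ.contMDiff_invFun.contDiff hγ
  refine ⟨hopfMetric (hγ := hγ) hc hψ hpos hψT hpsh, puncturedSpace n, inferInstance,
    inferInstance, inferInstance, hopfProj γ hγ, potentialMetric ψ hψ hpsh,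
    ⟨isGaloisHolomorphicCovering_hopfProj, isKahler_potentialMetric, ?_, ?_⟩,
    fun x => ψ x, isKahlerPotential_potentialMetric, fun x => hpos x x.2, ?_⟩
  · intro φ hφ
    obtain ⟨g, hg⟩ := hφ.exists_smul
    obtain ⟨k, hk⟩ := exists_zpow_of_hopfGroup g
    rw [hg]
    refine ⟨contMDiff_hopfGroup_smul g, c ^ k, zpow_pos hc k, fun y v w => ?_⟩
    rw [(hasMFDerivAt_hopfGroup_smul hk y).mfderiv]
    change complexHessian ψ (g • y : puncturedSpace n) _ _ = c ^ k * complexHessian ψ y v w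
    rw [hk]
    exact complexHessian_zpow hc hψ hγ.map_center hψT k y.2 v w
  · refine ⟨fun x => (ψ x)⁻¹, fun x => ?_, fun x => inv_pos.2 (hpos x x.2), fun y v w => ?_⟩
    · exact ContMDiffAt.comp (g := fun z => (ψ z)⁻¹) x
        ((hψ x x.2).inv (hpos x x.2).ne').contMDiffAt contMDiff_subtype_val.contMDiffAt
    · obtain ⟨g, hg⟩ := exists_smul_eq_quotientRep (G := hopfGroup γ hγ) y
      obtain ⟨k, hk⟩ := exists_zpow_of_hopfGroup g
      have hck : c ^ k ≠ 0 := (zpow_pos hc k).ne'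
      have hd := hasMFDerivAt_quotientMk (𝕜 := ℝ) hg (hasMFDerivAt_hopfGroup_smul hk y)
      have hd' : mfderiv 𝓘(ℝ, EuclideanSpace ℂ (Fin n)) 𝓘(ℝ, EuclideanSpace ℂ (Fin n))
        (hopfProj γ hγ) y = _ := hd.mfderiv
      rw [hd']
      change (ψ (quotientRep (hopfProj γ hγ y) : puncturedSpace n))⁻¹ *
        complexHessian ψ (quotientRep (hopfProj γ hγ y) : puncturedSpace n) _ _ =
        (ψ y)⁻¹ * complexHessian ψ y v w
      rw [show quotientRep (hopfProj γ hγ y) = g • y from hg.symm, hk,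
        apply_zpow_of_automorphic (T := γ.toEquiv) hγ.map_center hc hψT k y.2]
      refine (congrArg (_ * ·)
        (complexHessian_zpow hc hψ hγ.map_center hψT k y.2 v w)).trans ?_
      field_simp
  · intro φ hφ
    obtain ⟨g, hg⟩ := hφ.exists_smul
    obtain ⟨k, hk⟩ := exists_zpow_of_hopfGroup g
    refine ⟨c ^ k, fun y => ?_⟩
    rw [hg, hk]
    exact apply_zpow_of_automorphic (T := γ.toEquiv) hγ.map_center hc hψT k y.2
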